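/- Let $(W,S)$ be a Coxeter system with $S$ finite, let $\Bbbk$ be an integral domain, and let $\mathfrak h=(V,\{\alpha_s^\vee\}_{s\in S}\subset V,\{\alpha_s\}_{s\in S}\subset V^*)$ be a balanced realization of $(W,S)$ over $\Bbbk$ that satisfies Demazure surjectivity, where $V$ is a free $\Bbbk$-module of finite rank. Let $\mathscr D_{BS}$ be the associated Elias–Williamson diagrammatic category, with objects $B_{\underline w}(n)$ for words $\underline w$ in $S$ and $n\in\mathbb Z$; for a parabolic subsystem of type $H_3$, the three-colour relation equates two composites of braid moves up to a combination of degree-$0$ diagrams that factor through shorter words, and the statement holds for every choice of such a relation. Let $\mathscr D_{BS}^\oplus$ be the additive hull of $\mathscr D_{BS}$. For $r\in R=\mathrm{Sym}(V^*)=\mathrm{End}^\bullet(B_\varnothing)$ and a morphism $f$, write $r\star f$ and $f\star r$ for $f$ with the box $r$ placed to its left and to its right. Let $\Lambda=\bigwedge V^*$, with $V^*$ in bidegree $(1,2)$, and $R^\vee=\mathrm{Sym}(V)$, with $V$ in bidegree $(0,-2)$. A $\mathscr D_{BS}^\oplus$-sequence is a family $\mathcal F=(\mathcal F^p)_{p\in\mathbb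 Z}$ of objects of $\mathscr D_{BS}^\oplus$, almost all of them zero. For two such sequences put $$\underline{\mathrm{Hom}}_{BE}(\mathcal F,\mathcal G)^i_j=\prod_{q-p=i-j}\mathrm{Hom}_{\mathscr D_{BS}^\oplus}(\mathcal F^p,\mathcal G^q(j)),\qquad \underline{\mathrm{Hom}}_{FM}(\mathcal F,\mathcal G)=\Lambda\otimes\underline{\mathrm{Hom}}_{BE}(\mathcal F,\mathcal G)\otimes R^\vee,$$ with the composition $(r\otimes f\otimes x)\circ(s\otimes g\otimes y)=(-1)^{|f||s|}(r\wedge s)\otimes(f\circ g)\otimes xy$, where $|\cdot|$ is the first (cohomological) degree. Define $$\kappa\bigl((r_1\wedge\dots\wedge r_k)\otimes f\otimes x\bigr)=\sum_{i=1}^k(-1)^{i+1}(r_1\wedge\dots\widehat{r_i}\dots\wedge r_k)\otimes(r_i\star f)\otimes x$$ and $\Theta=\sum_i 1\otimes(\mathrm{id}\star e_i)\otimes\check e_i$, where $(e_i)$ and $(\check e_i)$ are dual bases of $V^*$ and $V$. A free-monodromic complex is a pair $(\mathcal F,\delta_{\mathcal F})$ of a $\mathscr D_{BS}^\oplus$-sequence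 $\mathcal F$ and an element $\delta_{\mathcal F}\in\underline{\mathrm{End}}_{FM}(\mathcal F)^1_0$ with $\delta_{\mathcal F}\circ\delta_{\mathcal F}+\kappa(\delta_{\mathcal F})=\Theta$. For free-monodromic complexes $\mathcal F,\mathcal G$, let $\mathrm{gHom}_{FM}(\mathcal F,\mathcal G)$ be the bigraded cohomology of $\underline{\mathrm{Hom}}_{FM}(\mathcal F,\mathcal G)$ with respect to the differential $$d(f)=\kappa(f)+\delta_{\mathcal G}\circ f+(-1)^{|f|+1}f\circ\delta_{\mathcal F},$$ with the induced composition, and put $\mathrm{gEnd}_{FM}(\mathcal F)=\mathrm{gHom}_{FM}(\mathcal F,\mathcal F)$. For $x\in V$ let $x\frown(-)$ be the operator on $\underline{\mathrm{Hom}}_{FM}$ induced by the contraction $$x\frown(r_1\wedge\dots\wedge r_k)=\sum_{i=1}^k(-1)^{i+1}r_i(x)\,r_1\wedge\dots\widehat{r_i}\dots\wedge r_k .$$ Then the following hold for all free-monodromic complexes $\mathcal F,\mathcal G,\mathcal H$. 1. For each $x\in V$ the element $x\frown\delta_{\mathcal F}$ is a cocycle, and there is a unique $\Bbbk$-algebra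 homomorphism $\mu_{\mathcal F}:R^\vee\to\mathrm{gEnd}_{FM}(\mathcal F)$ with $\mu_{\mathcal F}(x)=[x\frown\delta_{\mathcal F}]$ for all $x\in V$. It is bigraded. 2. For $x\in R^\vee$ and $f\in\mathrm{gHom}_{FM}(\mathcal F,\mathcal G)$ one has $\mu_{\mathcal G}(x)\circ f=f\circ\mu_{\mathcal F}(x)$, and $x\,\hat\star\,f:=\mu_{\mathcal G}(x)\circ f$ makes $\mathrm{gHom}_{FM}(\mathcal F,\mathcal G)$ a bigraded left $R^\vee$-module (left monodromy). For $g\in\mathrm{gHom}_{FM}(\mathcal G,\mathcal H)$, $$x\,\hat\star\,(g\circ f)=(x\,\hat\star\,g)\circ f=g\circ(x\,\hat\star\,f).$$ 3. The differential $d$ commutes with the right action $(r\otimes f\otimes x)\cdot y=r\otimes f\otimes xy$ of $R^\vee$ on $\underline{\mathrm{Hom}}_{FM}(\mathcal F,\mathcal G)$. The induced action $f\,\hat\star\,y$ makes $\mathrm{gHom}_{FM}(\mathcal F,\mathcal G)$ a bigraded right $R^\vee$-module (right monodromy), and $$(g\circ f)\,\hat\star\,y=(g\,\hat\star\,y)\circ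 f=g\circ(f\,\hat\star\,y).$$ 4. The two actions commute, $(x\,\hat\star\,f)\,\hat\star\,y=x\,\hat\star\,(f\,\hat\star\,y)$, so $\mathrm{gHom}_{FM}(\mathcal F,\mathcal G)$ is an $R^\vee$-bimodule. -/

import Mathlib

/-! ## Realizations of Coxeter systems -/

/-- The value `[n]_x` at `(x, y)` of the two-coloured quantum numbers; `[n]_y` is `twoColorQ y x n`. -/
def twoColorQ {R : Type*} [CommRing R] (x y : R) : ℕ → R
  | 0 => 0
  | 1 => 1
  | n + 2 => (if Even n then x else y) * twoColorQ x y (n + 1) - twoColorQ x y n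

/-- A realization of the Coxeter system `(W, S)` (with `S` indexed by `B`) over `𝕜`. -/
structure Realization {B W : Type*} [Group W] {M : CoxeterMatrix B} (cs : CoxeterSystem M W)
    (𝕜 V : Type*) [CommRing 𝕜] [AddCommGroup V] [Module 𝕜 V] where
  coroot : B → V
  root : B → Module.Dual 𝕜 V
  root_coroot : ∀ s, root s (coroot s) = 2
  exists_rep : ∃ ρ : Representation 𝕜 W V,
    ∀ s v, ρ (cs.simple s) v = v - root s v • coroot s
  quantum_eq_zero : ∀ s t, s ≠ t → M s t ≠ 0 →
    twoColorQ (-(root t (coroot s))) (-(root s (coroot t))) (M s t) = 0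

/-! ## Cohomology -/

section Cohomology

variable {𝕜 X Y Z : Type*} [CommRing 𝕜] [AddCommGroup X] [Module 𝕜 X] [AddCommGroup Y]
  [Module 𝕜 Y] [AddCommGroup Z] [Module 𝕜 Z]

/-- The total cohomology (cocycles modulo coboundaries) of a differential `d`. -/
def Cohomology (d : X →ₗ[𝕜] X) : Type _ :=
  LinearMap.ker d ⧸ (LinearMap.range d).submoduleOf (LinearMap.ker d)

namespace Cohomology

variable {d : X →ₗ[𝕜] X} {d' : Y →ₗ[𝕜] Y} {d'' : Z →ₗ[𝕜] Z}

instance : AddCommGroup (Cohomology d) :=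
  inferInstanceAs (AddCommGroup (LinearMap.ker d ⧸ _))

instance : Module 𝕜 (Cohomology d) := inferInstanceAs (Module 𝕜 (LinearMap.ker d ⧸ _))

def mkₗ (d : X →ₗ[𝕜] X) : LinearMap.ker d →ₗ[𝕜] Cohomology d := Submodule.mkQ _

/-- The class of a cocycle. -/
def mk (x : X) (hx : d x = 0) : Cohomology d := mkₗ d ⟨x, hx⟩

theorem ind {p : Cohomology d → Prop} (h : ∀ x hx, p (mk x hx)) (z : Cohomology d) : p z := by
  obtain ⟨⟨x, hx⟩, rfl⟩ := Submodule.Quotient.mk_surjective _ z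
  exact h x hx

theorem mk_eq_zero_iff {x : X} {hx : d x = 0} : mk x hx = 0 ↔ ∃ y, d y = x :=
  Submodule.Quotient.mk_eq_zero _

theorem mk_eq_mk_iff {x y : X} {hx : d x = 0} {hy : d y = 0} :
    mk x hx = mk y hy ↔ ∃ z, d z = x - y :=
  Submodule.Quotient.eq _

/-- The classes of the cocycles that belong to a given submodule. -/
def classes (d : X →ₗ[𝕜] X) (N : Submodule 𝕜 X) : Submodule 𝕜 (Cohomology d) :=
  (N.submoduleOf (LinearMap.ker d)).map (mkₗ d)

/-- The bilinear map induced on cohomology by a bilinear map that is compatible with cocycles and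
coboundaries. -/
def map₂ (β : X →ₗ[𝕜] Y →ₗ[𝕜] Z) (h : ∀ x y, d x = 0 → d' y = 0 → d'' (β x y) = 0)
    (hl : ∀ x y, d' y = 0 → ∃ z, d'' z = β (d x) y)
    (hr : ∀ x y, d x = 0 → ∃ z, d'' z = β x (d' y)) :
    Cohomology d →ₗ[𝕜] Cohomology d' →ₗ[𝕜] Cohomology d'' :=
  Submodule.liftQ _
    (LinearMap.flip <| Submodule.liftQ _
      (LinearMap.flip <| LinearMap.mk₂ 𝕜
        (fun (x : LinearMap.ker d) (y : LinearMap.ker d') => mk (β x.1 y.1) (h _ _ x.2 y.2))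
        (fun _ _ _ => by simp only [mk, ← map_add]; congr 1; ext1; simp)
        (fun _ _ _ => by simp only [mk, ← map_smul]; congr 1; ext1; simp)
        (fun _ _ _ => by simp only [mk, ← map_add]; congr 1; ext1; simp)
        (fun _ _ _ => by simp only [mk, ← map_smul]; congr 1; ext1; simp)) <| by
        rintro ⟨_, _⟩ ⟨y, rfl⟩
        ext ⟨x, hx⟩
        exact mk_eq_zero_iff.mpr (hr x y hx))
    (by
      rintro ⟨_, _⟩ ⟨x, rfl⟩
      ext ⟨y, hy⟩
      exact mk_eq_zero_iff.mpr (hl x y hy))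

theorem map₂_mk (β : X →ₗ[𝕜] Y →ₗ[𝕜] Z) (h : ∀ x y, d x = 0 → d' y = 0 → d'' (β x y) = 0)
    (hl : ∀ x y, d' y = 0 → ∃ z, d'' z = β (d x) y)
    (hr : ∀ x y, d x = 0 → ∃ z, d'' z = β x (d' y)) (x : X) (hx : d x = 0) (y : Y)
    (hy : d' y = 0) :
    map₂ β h hl hr (mk x hx) (mk y hy) = mk (β x y) (h x y hx hy) := rfl

end Cohomology

end Cohomology

section EliasWilliamson

variable {B W : Type*} [Group W] {M : CoxeterMatrix B} {cs : CoxeterSystem M W}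
  {𝕜 V : Type*} [CommRing 𝕜] [AddCommGroup V] [Module 𝕜 V]

namespace Realization

def IsBalanced (𝔥 : Realization cs 𝕜 V) : Prop :=
  ∀ s t, s ≠ t → M s t ≠ 0 →
    twoColorQ (-(𝔥.root t (𝔥.coroot s))) (-(𝔥.root s (𝔥.coroot t))) (M s t - 1) = 1

def DemazureSurjective (𝔥 : Realization cs 𝕜 V) : Prop :=
  ∀ s, Function.Surjective (𝔥.root s) ∧
    Function.Surjective (fun lam : Module.Dual 𝕜 V => lam (𝔥.coroot s))

/-- The action of a simple reflection on `V^*`. -/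
def dualRefl (𝔥 : Realization cs 𝕜 V) (s : B) : Module.Dual 𝕜 V →ₗ[𝕜] Module.Dual 𝕜 V :=
  LinearMap.id - (Module.Dual.eval 𝕜 V (𝔥.coroot s)).smulRight (𝔥.root s)

/-- The action of a simple reflection on the symmetric algebra of `V^*`. -/
noncomputable def symRefl (𝔥 : Realization cs 𝕜 V) (s : B) :
    SymmetricAlgebra 𝕜 (Module.Dual 𝕜 V) →ₐ[𝕜] SymmetricAlgebra 𝕜 (Module.Dual 𝕜 V) :=
  SymmetricAlgebra.lift (SymmetricAlgebra.ι 𝕜 (Module.Dual 𝕜 V) ∘ₗ 𝔥.dualRefl s)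

end Realization

/-- The part of polynomial degree `k` of a symmetric algebra. -/
noncomputable def symDeg (𝕜 N : Type*) [CommRing 𝕜] [AddCommGroup N] [Module 𝕜 N] (k : ℕ) :
    Submodule 𝕜 (SymmetricAlgebra 𝕜 N) :=
  LinearMap.range (SymmetricAlgebra.ι 𝕜 N) ^ k

/-! ## Elias–Williamson diagrams -/

/-- The alternating word `s, t, s, …` with `n` letters. -/
def altWord (s t : B) : ℕ → List B
  | 0 => []
  | n + 1 => s :: altWord t s n

/-- Formal `𝕜`-linear combinations of horizontal and vertical concatenations of the generating
diagrams; `Diagram 𝔥 v w` has bottom boundary `v` and top boundary `w`. -/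
inductive Diagram (𝔥 : Realization cs 𝕜 V) : List B → List B → Type _
  | zero {v w : List B} : Diagram 𝔥 v w
  | add {v w : List B} (d e : Diagram 𝔥 v w) : Diagram 𝔥 v w
  | smul {v w : List B} (c : 𝕜) (d : Diagram 𝔥 v w) : Diagram 𝔥 v w
  | id (v : List B) : Diagram 𝔥 v v
  | comp {u v w : List B} (g : Diagram 𝔥 v w) (f : Diagram 𝔥 u v) : Diagram 𝔥 u w
  | tensor {v w v' w' : List B} (f : Diagram 𝔥 v w) (g : Diagram 𝔥 v' w') :
      Diagram 𝔥 (v ++ v') (w ++ w')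
  | box (f : SymmetricAlgebra 𝕜 (Module.Dual 𝕜 V)) : Diagram 𝔥 [] []
  | endDot (s : B) : Diagram 𝔥 [s] []
  | startDot (s : B) : Diagram 𝔥 [] [s]
  | split (s : B) : Diagram 𝔥 [s] [s, s]
  | merge (s : B) : Diagram 𝔥 [s, s] [s]
  | vertex (s t : B) (hst : s ≠ t) (hm : M s t ≠ 0) :
      Diagram 𝔥 (altWord s t (M s t)) (altWord t s (M s t))

namespace Diagram

variable {𝔥 : Realization cs 𝕜 V}

/-- Transport along equalities of boundary words. -/
def cast {v w v' w' : List B} (hv : v = v') (hw : w = w') (d : Diagram 𝔥 v w) :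
    Diagram 𝔥 v' w' :=
  match hv, hw with
  | rfl, rfl => d

/-- The diagram `g` with vertical strands `u` to its left and `v` to its right. -/
def layer (u v : List B) {a b x y : List B} (g : Diagram 𝔥 a b)
    (hx : u ++ (a ++ v) = x) (hy : u ++ (b ++ v) = y) : Diagram 𝔥 x y :=
  cast hx hy (tensor (id u) (tensor g (id v)))

def cap (s : B) : Diagram 𝔥 [s, s] [] := comp (endDot s) (merge s)

def cup (s : B) : Diagram 𝔥 [] [s, s] := comp (split s) (startDot s)

/-- Homogeneous diagrams, with their degree. -/
inductive IsHomog : ∀ {v w : List B}, Diagram 𝔥 v w → ℤ → Prop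
  | zero {v w : List B} (n : ℤ) : IsHomog (zero : Diagram 𝔥 v w) n
  | add {v w : List B} {d e : Diagram 𝔥 v w} {n : ℤ} :
      IsHomog d n → IsHomog e n → IsHomog (add d e) n
  | smul {v w : List B} (c : 𝕜) {d : Diagram 𝔥 v w} {n : ℤ} :
      IsHomog d n → IsHomog (smul c d) n
  | id (v : List B) : IsHomog (id v) 0
  | comp {u v w : List B} {g : Diagram 𝔥 v w} {f : Diagram 𝔥 u v} {m n : ℤ} :
      IsHomog g m → IsHomog f n → IsHomog (comp g f) (m + n)
  | tensor {v w v' w' : List B} {f : Diagram 𝔥 v w} {g : Diagram 𝔥 v' w'} {m n : ℤ} :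
      IsHomog f m → IsHomog g n → IsHomog (tensor f g) (m + n)
  | box (f : SymmetricAlgebra 𝕜 (Module.Dual 𝕜 V)) (k : ℕ)
      (hf : f ∈ symDeg 𝕜 (Module.Dual 𝕜 V) k) : IsHomog (box f) (2 * k)
  | endDot (s : B) : IsHomog (endDot s) 1
  | startDot (s : B) : IsHomog (startDot s) 1
  | split (s : B) : IsHomog (split s) (-1)
  | merge (s : B) : IsHomog (merge s) (-1)
  | vertex (s t : B) (hst : s ≠ t) (hm : M s t ≠ 0) : IsHomog (vertex s t hst hm) 0

end Diagram

open Diagram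

/-- A family of relations between parallel diagrams. -/
abbrev LocalRel (𝔥 : Realization cs 𝕜 V) :=
  ∀ v w : List B, Diagram 𝔥 v w → Diagram 𝔥 v w → Prop

/-- The congruence generated by `E`, the laws of a strict `𝕜`-linear monoidal category, and the
rule that boxes add and multiply. -/
inductive Cong {𝔥 : Realization cs 𝕜 V} (E : LocalRel 𝔥) :
    ∀ {v w : List B}, Diagram 𝔥 v w → Diagram 𝔥 v w → Prop
  | of {v w : List B} {d e : Diagram 𝔥 v w} : E v w d e → Cong E d e
  | refl {v w : List B} (d : Diagram 𝔥 v w) : Cong E d d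
  | symm {v w : List B} {d e : Diagram 𝔥 v w} : Cong E d e → Cong E e d
  | trans {v w : List B} {d e f : Diagram 𝔥 v w} : Cong E d e → Cong E e f → Cong E d f
  | add_congr {v w : List B} {d d' e e' : Diagram 𝔥 v w} :
      Cong E d d' → Cong E e e' → Cong E (add d e) (add d' e')
  | smul_congr {v w : List B} (c : 𝕜) {d d' : Diagram 𝔥 v w} :
      Cong E d d' → Cong E (smul c d) (smul c d')
  | comp_congr {u v w : List B} {g g' : Diagram 𝔥 v w} {f f' : Diagram 𝔥 u v} :
      Cong E g g' → Cong E f f' → Cong E (comp g f) (comp g' f')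
  | tensor_congr {v w v' w' : List B} {f f' : Diagram 𝔥 v w} {g g' : Diagram 𝔥 v' w'} :
      Cong E f f' → Cong E g g' → Cong E (tensor f g) (tensor f' g')
  | add_comm {v w : List B} (d e : Diagram 𝔥 v w) : Cong E (add d e) (add e d)
  | add_assoc {v w : List B} (d e f : Diagram 𝔥 v w) :
      Cong E (add (add d e) f) (add d (add e f))
  | zero_add {v w : List B} (d : Diagram 𝔥 v w) : Cong E (add zero d) d
  | neg_add {v w : List B} (d : Diagram 𝔥 v w) : Cong E (add (smul (-1) d) d) zero
  | one_smul {v w : List B} (d : Diagram 𝔥 v w) : Cong E (smul 1 d) d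
  | mul_smul {v w : List B} (a b : 𝕜) (d : Diagram 𝔥 v w) :
      Cong E (smul (a * b) d) (smul a (smul b d))
  | smul_add {v w : List B} (a : 𝕜) (d e : Diagram 𝔥 v w) :
      Cong E (smul a (add d e)) (add (smul a d) (smul a e))
  | add_smul {v w : List B} (a b : 𝕜) (d : Diagram 𝔥 v w) :
      Cong E (smul (a + b) d) (add (smul a d) (smul b d))
  | add_comp {u v w : List B} (g g' : Diagram 𝔥 v w) (f : Diagram 𝔥 u v) :
      Cong E (comp (add g g') f) (add (comp g f) (comp g' f))
  | comp_add {u v w : List B} (g : Diagram 𝔥 v w) (f f' : Diagram 𝔥 u v) :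
      Cong E (comp g (add f f')) (add (comp g f) (comp g f'))
  | smul_comp {u v w : List B} (c : 𝕜) (g : Diagram 𝔥 v w) (f : Diagram 𝔥 u v) :
      Cong E (comp (smul c g) f) (smul c (comp g f))
  | comp_smul {u v w : List B} (c : 𝕜) (g : Diagram 𝔥 v w) (f : Diagram 𝔥 u v) :
      Cong E (comp g (smul c f)) (smul c (comp g f))
  | id_comp {v w : List B} (d : Diagram 𝔥 v w) : Cong E (comp (Diagram.id w) d) d
  | comp_id {v w : List B} (d : Diagram 𝔥 v w) : Cong E (comp d (Diagram.id v)) d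
  | comp_assoc {u v w x : List B} (h : Diagram 𝔥 w x) (g : Diagram 𝔥 v w) (f : Diagram 𝔥 u v) :
      Cong E (comp (comp h g) f) (comp h (comp g f))
  | add_tensor {v w v' w' : List B} (f f' : Diagram 𝔥 v w) (g : Diagram 𝔥 v' w') :
      Cong E (tensor (add f f') g) (add (tensor f g) (tensor f' g))
  | tensor_add {v w v' w' : List B} (f : Diagram 𝔥 v w) (g g' : Diagram 𝔥 v' w') :
      Cong E (tensor f (add g g')) (add (tensor f g) (tensor f g'))
  | smul_tensor {v w v' w' : List B} (c : 𝕜) (f : Diagram 𝔥 v w) (g : Diagram 𝔥 v' w') :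
      Cong E (tensor (smul c f) g) (smul c (tensor f g))
  | tensor_smul {v w v' w' : List B} (c : 𝕜) (f : Diagram 𝔥 v w) (g : Diagram 𝔥 v' w') :
      Cong E (tensor f (smul c g)) (smul c (tensor f g))
  | id_tensor_id (v w : List B) :
      Cong E (tensor (Diagram.id v) (Diagram.id w)) (Diagram.id (v ++ w))
  | interchange {u v w u' v' w' : List B} (g : Diagram 𝔥 v w) (f : Diagram 𝔥 u v)
      (g' : Diagram 𝔥 v' w') (f' : Diagram 𝔥 u' v') :
      Cong E (tensor (comp g f) (comp g' f')) (comp (tensor g g') (tensor f f'))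
  | tensor_assoc {v w v' w' v'' w'' : List B} (f : Diagram 𝔥 v w) (g : Diagram 𝔥 v' w')
      (h : Diagram 𝔥 v'' w'') :
      Cong E (Diagram.cast (List.append_assoc _ _ _) (List.append_assoc _ _ _)
        (tensor (tensor f g) h)) (tensor f (tensor g h))
  | unit_tensor {v w : List B} (d : Diagram 𝔥 v w) : Cong E (tensor (Diagram.id []) d) d
  | tensor_unit {v w : List B} (d : Diagram 𝔥 v w) :
      Cong E (Diagram.cast (List.append_nil _) (List.append_nil _)
        (tensor d (Diagram.id []))) d
  | box_add (f g : SymmetricAlgebra 𝕜 (Module.Dual 𝕜 V)) :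
      Cong E (box (f + g)) (add (box f) (box g))
  | box_smul (c : 𝕜) (f : SymmetricAlgebra 𝕜 (Module.Dual 𝕜 V)) :
      Cong E (box (c • f)) (smul c (box f))
  | box_one : Cong E (box 1) (Diagram.id [])
  | box_mul (f g : SymmetricAlgebra 𝕜 (Module.Dual 𝕜 V)) :
      Cong E (box (f * g)) (comp (box f) (box g))

/-- The relations that involve strands of one colour. -/
inductive OneColor (𝔥 : Realization cs 𝕜 V) : LocalRel 𝔥
  | counit_right (s : B) :
      OneColor 𝔥 [s] [s] (comp (tensor (Diagram.id [s]) (endDot s)) (split s)) (Diagram.id [s])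
  | counit_left (s : B) :
      OneColor 𝔥 [s] [s] (comp (tensor (endDot s) (Diagram.id [s])) (split s)) (Diagram.id [s])
  | unit_right (s : B) :
      OneColor 𝔥 [s] [s] (comp (merge s) (tensor (Diagram.id [s]) (startDot s))) (Diagram.id [s])
  | unit_left (s : B) :
      OneColor 𝔥 [s] [s] (comp (merge s) (tensor (startDot s) (Diagram.id [s]))) (Diagram.id [s])
  | frobenius_right (s : B) :
      OneColor 𝔥 [s, s] [s, s]
        (comp (tensor (Diagram.id [s]) (merge s)) (tensor (split s) (Diagram.id [s])))
        (comp (split s) (merge s))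
  | frobenius_left (s : B) :
      OneColor 𝔥 [s, s] [s, s]
        (comp (tensor (merge s) (Diagram.id [s])) (tensor (Diagram.id [s]) (split s)))
        (comp (split s) (merge s))
  | needle (s : B) : OneColor 𝔥 [s] [s] (comp (merge s) (split s)) zero
  | barbell (s : B) :
      OneColor 𝔥 [] [] (comp (endDot s) (startDot s))
        (box (SymmetricAlgebra.ι 𝕜 (Module.Dual 𝕜 V) (𝔥.root s)))
  /-- Here `g` is the Demazure quotient `(f - s f) / α_s`. -/
  | nilHecke (s : B) (f g : SymmetricAlgebra 𝕜 (Module.Dual 𝕜 V))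
      (hg : SymmetricAlgebra.ι 𝕜 (Module.Dual 𝕜 V) (𝔥.root s) * g = f - 𝔥.symRefl s f) :
      OneColor 𝔥 [s] [s] (tensor (box f) (Diagram.id [s]))
        (add (tensor (Diagram.id [s]) (box (𝔥.symRefl s f)))
          (comp (startDot s) (comp (box g) (endDot s))))

/-- The linear combinations of diagrams `a ∘ c` that factor through a word shorter than the bottom
word, with `a` and `c` in the class `T`. -/
inductive IsLower {𝔥 : Realization cs 𝕜 V} (T : ∀ v w : List B, Diagram 𝔥 v w → Prop) :
    ∀ {v w : List B}, Diagram 𝔥 v w → Prop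
  | zero {v w : List B} : IsLower T (zero : Diagram 𝔥 v w)
  | add {v w : List B} {d e : Diagram 𝔥 v w} : IsLower T d → IsLower T e → IsLower T (add d e)
  | smul {v w : List B} (c : 𝕜) {d : Diagram 𝔥 v w} : IsLower T d → IsLower T (smul c d)
  | factor {v x w : List B} (a : Diagram 𝔥 x w) (c : Diagram 𝔥 v x) :
      T x w a → T v x c → x.length < v.length → IsLower T (comp a c)

/-- The pitchfork `u w u → u`, the image of a cap of the two-coloured Temperley–Lieb category. -/
def pitchCap {𝔥 : Realization cs 𝕜 V} (u w : B) : Diagram 𝔥 [u, w, u] [u] :=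
  comp (merge u) (tensor (Diagram.id [u]) (tensor (endDot w) (Diagram.id [u])))

/-- The pitchfork `u → u w u`, the image of a cup of the two-coloured Temperley–Lieb category. -/
def pitchCup {𝔥 : Realization cs 𝕜 V} (u w : B) : Diagram 𝔥 [u] [u, w, u] :=
  comp (tensor (Diagram.id [u]) (tensor (startDot w) (Diagram.id [u]))) (split u)

/-- Images of Temperley–Lieb diagrams in the colours `s`, `t`. -/
inductive IsTL {𝔥 : Realization cs 𝕜 V} (s t : B) :
    ∀ v w : List B, Diagram 𝔥 v w → Prop
  | id (v : List B) : IsTL s t v v (Diagram.id v)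
  | comp {u v w : List B} {g : Diagram 𝔥 v w} {f : Diagram 𝔥 u v} :
      IsTL s t v w g → IsTL s t u v f → IsTL s t u w (comp g f)
  | cap_st {a b x y : List B} (hx : a ++ ([s, t, s] ++ b) = x) (hy : a ++ ([s] ++ b) = y) :
      IsTL s t x y (layer a b (pitchCap s t) hx hy)
  | cap_ts {a b x y : List B} (hx : a ++ ([t, s, t] ++ b) = x) (hy : a ++ ([t] ++ b) = y) :
      IsTL s t x y (layer a b (pitchCap t s) hx hy)
  | cup_st {a b x y : List B} (hx : a ++ ([s] ++ b) = x) (hy : a ++ ([s, t, s] ++ b) = y) :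
      IsTL s t x y (layer a b (pitchCup s t) hx hy)
  | cup_ts {a b x y : List B} (hx : a ++ ([t] ++ b) = x) (hy : a ++ ([t, s, t] ++ b) = y) :
      IsTL s t x y (layer a b (pitchCup t s) hx hy)

/-- `J` is the Jones–Wenzl projector on the word `w` in the colours `s`, `t`: the identity plus a
combination of Temperley–Lieb diagrams through shorter words, killed by all pitchforks. -/
structure IsJonesWenzl {𝔥 : Realization cs 𝕜 V} (s t : B) (w : List B) (J : Diagram 𝔥 w w) :
    Prop where
  expand : ∃ K : Diagram 𝔥 w w, IsLower (IsTL s t) K ∧ J = add (Diagram.id w) K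
  cap_st : ∀ (a b y : List B) (hx : a ++ ([s, t, s] ++ b) = w) (hy : a ++ ([s] ++ b) = y),
    Cong (OneColor 𝔥) (comp (layer a b (pitchCap s t) hx hy) J) zero
  cap_ts : ∀ (a b y : List B) (hx : a ++ ([t, s, t] ++ b) = w) (hy : a ++ ([t] ++ b) = y),
    Cong (OneColor 𝔥) (comp (layer a b (pitchCap t s) hx hy) J) zero
  cup_st : ∀ (a b y : List B) (hx : a ++ ([s] ++ b) = y) (hy : a ++ ([s, t, s] ++ b) = w),
    Cong (OneColor 𝔥) (comp J (layer a b (pitchCup s t) hx hy)) zero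
  cup_ts : ∀ (a b y : List B) (hx : a ++ ([t] ++ b) = y) (hy : a ++ ([t, s, t] ++ b) = w),
    Cong (OneColor 𝔥) (comp J (layer a b (pitchCup t s) hx hy)) zero

/-- The relations that involve strands of two colours. In each of them `n` is `m_st - 1`, and `x`
and `y` are the last letters of the alternating words of length `m_st` starting with `s` and `t`. -/
inductive TwoColor (𝔥 : Realization cs 𝕜 V) : LocalRel 𝔥
  | cyclic_left (s t : B) (hst : s ≠ t) (hm : M s t ≠ 0) (hm' : M t s ≠ 0) (n : ℕ) (x : B)
      (h₁ : altWord s t (M s t) = altWord s t n ++ [x])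
      (h₂ : altWord t s (M s t) = t :: altWord s t n)
      (h₃ : altWord t s (M t s) = t :: altWord s t n)
      (h₄ : altWord s t (M t s) = altWord s t n ++ [x]) :
      TwoColor 𝔥 (t :: altWord s t n) (altWord s t n ++ [x])
        (comp (layer [] (altWord s t n ++ [x]) (cap t) rfl rfl)
          (comp (layer [t] [x] (vertex s t hst hm)
              (x := t :: (altWord s t n ++ [x, x])) (y := t :: t :: (altWord s t n ++ [x]))
              (by simp [h₁]) (by simp [h₂]))
            (layer (t :: altWord s t n) [] (cup x) (by simp) (by simp))))
        (Diagram.cast h₃ h₄ (vertex t s hst.symm hm'))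
  | cyclic_right (s t : B) (hst : s ≠ t) (hm : M s t ≠ 0) (hm' : M t s ≠ 0) (n : ℕ) (y : B)
      (h₁ : altWord s t (M s t) = s :: altWord t s n)
      (h₂ : altWord t s (M s t) = altWord t s n ++ [y])
      (h₃ : altWord t s (M t s) = altWord t s n ++ [y])
      (h₄ : altWord s t (M t s) = s :: altWord t s n) :
      TwoColor 𝔥 (altWord t s n ++ [y]) (s :: altWord t s n)
        (comp (layer (s :: altWord t s n) [] (cap y)
            (x := s :: (altWord t s n ++ [y, y])) (by simp) (by simp))
          (comp (layer [s] [y] (vertex s t hst hm)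
              (x := s :: s :: (altWord t s n ++ [y])) (by simp [h₁]) (by simp [h₂]))
            (layer [] (altWord t s n ++ [y]) (cup s) rfl rfl)))
        (Diagram.cast h₃ h₄ (vertex t s hst.symm hm'))
  | assoc (s t : B) (hst : s ≠ t) (hm : M s t ≠ 0) (n : ℕ) (y : B)
      (h₁ : altWord s t (M s t) = s :: altWord t s n)
      (h₂ : altWord t s (M s t) = altWord t s n ++ [y]) :
      TwoColor 𝔥 (s :: altWord t s n) (altWord t s n ++ [y, y])
        (comp (layer (altWord t s n) [] (split y) (x := altWord t s n ++ [y]) (by simp) (by simp))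
          (Diagram.cast h₁ h₂ (vertex s t hst hm)))
        (comp (layer [] [y] (vertex s t hst hm)
            (x := s :: (altWord t s n ++ [y])) (by simp [h₁]) (by simp [h₂]))
          (comp (layer [s] [] (vertex s t hst hm)
              (x := s :: s :: altWord t s n) (by simp [h₁]) (by simp [h₂]))
            (layer [] (altWord t s n) (split s) rfl rfl)))
  | jonesWenzl (s t : B) (hst : s ≠ t) (hm : M s t ≠ 0) (n : ℕ) (y : B)
      (h₁ : altWord s t (M s t) = s :: altWord t s n)
      (h₂ : altWord t s (M s t) = altWord t s n ++ [y])
      (J : Diagram 𝔥 (s :: altWord t s n) (s :: altWord t s n))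
      (hJ : IsJonesWenzl s t (s :: altWord t s n) J) :
      TwoColor 𝔥 (s :: altWord t s n) (altWord t s n)
        (comp (layer (altWord t s n) [] (endDot y) (x := altWord t s n ++ [y])
            (by simp) (by simp))
          (Diagram.cast h₁ h₂ (vertex s t hst hm)))
        (comp (layer [] (altWord t s n) (endDot s) rfl rfl) J)

/-- `IsRexPath l d`: the diagram `d` is the composite of the `2m`-valent vertices (with vertical
strands on both sides) that realize the braid moves between successive words of the list `l`. -/
inductive IsRexPath {𝔥 : Realization cs 𝕜 V} :
    List (List B) → ∀ {v w : List B}, Diagram 𝔥 v w → Prop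
  | nil (w : List B) : IsRexPath [w] (Diagram.id w)
  | cons {v w x : List B} {l : List (List B)} (s t : B) (hst : s ≠ t) (hm : M s t ≠ 0)
      (a b : List B) (hv : a ++ (altWord s t (M s t) ++ b) = v)
      (hw : a ++ (altWord t s (M s t) ++ b) = w) {d : Diagram 𝔥 w x} (hd : IsRexPath (w :: l) d) :
      IsRexPath (v :: w :: l) (comp d (layer a b (vertex s t hst hm) hv hw))

/-- `d` moves a strand coloured `u` from the left to the right across the word `w`, all of whose
letters commute with `u`, through `4`-valent vertices. -/
inductive IsSlide {𝔥 : Realization cs 𝕜 V} (u : B) :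
    ∀ w : List B, Diagram 𝔥 (u :: w) (w ++ [u]) → Prop
  | nil : IsSlide u [] (Diagram.id [u])
  | cons (a : B) (w : List B) (hua : u ≠ a) (hm : M u a ≠ 0)
      (h₁ : altWord u a (M u a) = [u, a]) (h₂ : altWord a u (M u a) = [a, u])
      {d : Diagram 𝔥 (u :: w) (w ++ [u])} (hd : IsSlide u w d) :
      IsSlide u (a :: w)
        (comp (tensor (Diagram.id [a]) d : Diagram 𝔥 ([a] ++ (u :: w)) ([a] ++ (w ++ [u])))
          (layer [] w (vertex u a hua hm) (x := u :: a :: w) (y := a :: u :: w)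
            (by simp [h₁]) (by simp [h₂])))

/-- A three-colour relation of type `H₃` for the colours `r`, `s`, `t`: two composites of braid
moves between the same two reduced expressions of the longest element agree up to a given
combination of diagrams of degree `0` that factor through shorter words. -/
structure H3Relation (𝔥 : Realization cs 𝕜 V) (r s t : B) where
  src : List B
  tgt : List B
  src_letters : ∀ a ∈ src, a = r ∨ a = s ∨ a = t
  src_reduced : cs.IsReduced src
  src_length : src.length = 15
  path₁ : Diagram 𝔥 src tgt
  path₂ : Diagram 𝔥 src tgt
  isRexPath₁ : ∃ l, IsRexPath l path₁
  isRexPath₂ : ∃ l, IsRexPath l path₂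
  lower : Diagram 𝔥 src tgt
  lower_homog : lower.IsHomog 0
  lower_isLower : IsLower (fun _ _ _ => True) lower

/-- A choice of three-colour relation for each parabolic subsystem of type `H₃`. No closed formula
for the lower terms of that relation is available, so the choice is kept as a parameter. It is
the trivial choice if `(W, S)` has no parabolic subsystem of type `H₃`. -/
abbrev H3Data (𝔥 : Realization cs 𝕜 V) :=
  ∀ r s t : B, M r s = 5 → M s t = 3 → M r t = 2 → H3Relation 𝔥 r s t

/-- The Zamolodchikov relations, of types `A₁ × I₂(m)`, `A₃`, `B₃` and `H₃`. -/
inductive ThreeColor {𝔥 : Realization cs 𝕜 V} (Z : H3Data 𝔥) : LocalRel 𝔥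
  | a1I2 (s t u : B) (hst : s ≠ t) (hm : M s t ≠ 0) (hsu : M u s = 2) (htu : M u t = 2)
      (d : Diagram 𝔥 (u :: altWord s t (M s t)) (altWord s t (M s t) ++ [u]))
      (d' : Diagram 𝔥 (u :: altWord t s (M s t)) (altWord t s (M s t) ++ [u]))
      (hd : IsSlide u _ d) (hd' : IsSlide u _ d') :
      ThreeColor Z (u :: altWord s t (M s t)) (altWord t s (M s t) ++ [u])
        (comp (tensor (vertex s t hst hm) (Diagram.id [u])) d)
        (comp d' (tensor (Diagram.id [u]) (vertex s t hst hm)))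
  | a3 (s t u : B) (hst : M s t = 3) (htu : M t u = 3) (hsu : M s u = 2)
      (d d' : Diagram 𝔥 [s, u, t, s, u, t] [t, s, u, t, s, u])
      (hd : IsRexPath [[s, u, t, s, u, t], [s, u, t, u, s, t], [s, t, u, t, s, t],
        [s, t, u, s, t, s], [s, t, s, u, t, s], [t, s, t, u, t, s], [t, s, u, t, u, s],
        [t, s, u, t, s, u]] d)
      (hd' : IsRexPath [[s, u, t, s, u, t], [u, s, t, s, u, t], [u, t, s, t, u, t],
        [u, t, s, u, t, u], [u, t, u, s, t, u], [t, u, t, s, t, u], [t, u, s, t, s, u],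
        [t, s, u, t, s, u]] d') :
      ThreeColor Z [s, u, t, s, u, t] [t, s, u, t, s, u] d d'
  | b3 (s t u : B) (hst : M s t = 4) (htu : M t u = 3) (hsu : M s u = 2)
      (d d' : Diagram 𝔥 [s, u, t, s, u, t, s, u, t] [t, s, u, t, s, u, t, s, u])
      (hd : IsRexPath [
        [s, u, t, s, u, t, s, u, t], [s, u, t, u, s, t, s, u, t], [s, t, u, t, s, t, s, u, t],
        [s, t, u, s, t, s, t, u, t], [s, t, s, u, t, s, t, u, t], [s, t, s, u, t, s, u, t, u],
        [s, t, s, u, t, u, s, t, u], [s, t, s, t, u, t, s, t, u], [t, s, t, s, u, t, s, t, u],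
        [t, s, t, u, s, t, s, t, u], [t, s, t, u, t, s, t, s, u], [t, s, u, t, u, s, t, s, u],
        [t, s, u, t, s, u, t, s, u]] d)
      (hd' : IsRexPath [
        [s, u, t, s, u, t, s, u, t], [u, s, t, s, u, t, s, u, t], [u, s, t, s, u, t, u, s, t],
        [u, s, t, s, t, u, t, s, t], [u, t, s, t, s, u, t, s, t], [u, t, s, t, u, s, t, s, t],
        [u, t, s, t, u, t, s, t, s], [u, t, s, u, t, u, s, t, s], [u, t, u, s, t, u, s, t, s],
        [t, u, t, s, t, u, s, t, s], [t, u, t, s, t, s, u, t, s], [t, u, s, t, s, t, u, t, s],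
        [t, s, u, t, s, t, u, t, s], [t, s, u, t, s, u, t, u, s], [t, s, u, t, s, u, t, s, u]] d') :
      ThreeColor Z [s, u, t, s, u, t, s, u, t] [t, s, u, t, s, u, t, s, u] d d'
  | h3 (r s t : B) (hrs : M r s = 5) (hst : M s t = 3) (hrt : M r t = 2) :
      ThreeColor Z (Z r s t hrs hst hrt).src (Z r s t hrs hst hrt).tgt
        (Z r s t hrs hst hrt).path₁
        (add (Z r s t hrs hst hrt).path₂ (Z r s t hrs hst hrt).lower)

/-- The defining relations of the Elias–Williamson diagrammatic category. -/
def ewRel {𝔥 : Realization cs 𝕜 V} (Z : H3Data 𝔥) : LocalRel 𝔥 :=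
  fun v w d e => OneColor 𝔥 v w d e ∨ TwoColor 𝔥 v w d e ∨ ThreeColor Z v w d e

/-! ## Morphism spaces of the diagrammatic category -/

variable {𝔥 : Realization cs 𝕜 V}

namespace Diagram

theorem cast_congr {E : LocalRel 𝔥} {v w v' w' : List B} (hv : v = v') (hw : w = w')
    {d e : Diagram 𝔥 v w} (h : Cong E d e) : Cong E (cast hv hw d) (cast hv hw e) := by
  subst hv hw; exact h

end Diagram

/-- The graded `𝕜`-module of morphisms `B_v → B_w` in the strict `𝕜`-linear monoidal category
presented by the generating diagrams and the relations `E`. -/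
def DHom (E : LocalRel 𝔥) (v w : List B) : Type _ :=
  Quot (fun d e : Diagram 𝔥 v w => Cong E d e)

namespace DHom

variable {E : LocalRel 𝔥} {u v w x v' w' : List B}

def mk (E : LocalRel 𝔥) {v w : List B} (d : Diagram 𝔥 v w) : DHom E v w := Quot.mk _ d

theorem ind {p : DHom E v w → Prop} (h : ∀ d, p (mk E d)) (f : DHom E v w) : p f :=
  Quot.ind h f

theorem sound {d e : Diagram 𝔥 v w} (h : Cong E d e) : mk E d = mk E e := Quot.sound h

instance : Zero (DHom E v w) := ⟨mk E zero⟩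

instance : Add (DHom E v w) :=
  ⟨Quot.map₂ add (fun _ _ _ h => .add_congr (.refl _) h) (fun _ _ _ h => .add_congr h (.refl _))⟩

instance : SMul 𝕜 (DHom E v w) := ⟨fun c => Quot.map (smul c) (fun _ _ h => .smul_congr c h)⟩

instance : Neg (DHom E v w) := ⟨fun f => (-1 : 𝕜) • f⟩

theorem mk_add (d e : Diagram 𝔥 v w) : mk E (add d e) = mk E d + mk E e := rfl

theorem mk_smul (c : 𝕜) (d : Diagram 𝔥 v w) : mk E (smul c d) = c • mk E d := rfl

theorem mk_zero : mk E (zero : Diagram 𝔥 v w) = 0 := rfl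

instance : AddCommGroup (DHom E v w) where
  add_assoc := by
    rintro ⟨d⟩ ⟨e⟩ ⟨f⟩; exact sound (.add_assoc d e f)
  add_comm := by
    rintro ⟨d⟩ ⟨e⟩; exact sound (.add_comm d e)
  zero_add := by
    rintro ⟨d⟩; exact sound (.zero_add d)
  add_zero := by
    rintro ⟨d⟩; exact sound (.trans (.add_comm d zero) (.zero_add d))
  neg_add_cancel := by
    rintro ⟨d⟩; exact sound (.neg_add d)
  nsmul := nsmulRec
  zsmul := zsmulRec

instance : Module 𝕜 (DHom E v w) where
  one_smul := by
    rintro ⟨d⟩; exact sound (.one_smul d)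
  mul_smul := by
    rintro a b ⟨d⟩; exact sound (.mul_smul a b d)
  smul_add := by
    rintro a ⟨d⟩ ⟨e⟩; exact sound (.smul_add a d e)
  add_smul := by
    rintro a b ⟨d⟩; exact sound (.add_smul a b d)
  smul_zero := by
    intro a
    have h : a • (0 : DHom E v w) + a • (0 : DHom E v w) = a • (0 : DHom E v w) := by
      have h₁ : a • ((0 : DHom E v w) + 0) = a • (0 : DHom E v w) + a • (0 : DHom E v w) :=
        sound (.smul_add a zero zero)
      rw [← h₁, add_zero]
    exact left_eq_add.mp h.symm
  zero_smul := by
    rintro ⟨d⟩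
    have h : (0 : 𝕜) • mk E d + (0 : 𝕜) • mk E d = (0 : 𝕜) • mk E d := by
      have h₁ : ((0 : 𝕜) + 0) • mk E d = (0 : 𝕜) • mk E d + (0 : 𝕜) • mk E d :=
        sound (.add_smul 0 0 d)
      rw [← h₁, add_zero]
    exact left_eq_add.mp h.symm

def id (E : LocalRel 𝔥) (v : List B) : DHom E v v := mk E (Diagram.id v)

/-- Vertical concatenation. -/
def comp : DHom E v w →ₗ[𝕜] DHom E u v →ₗ[𝕜] DHom E u w :=
  LinearMap.mk₂ 𝕜
    (Quot.map₂ Diagram.comp (fun _ _ _ h => .comp_congr (.refl _) h)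
      (fun _ _ _ h => .comp_congr h (.refl _)))
    (by rintro ⟨g⟩ ⟨g'⟩ ⟨f⟩; exact sound (.add_comp g g' f))
    (by rintro c ⟨g⟩ ⟨f⟩; exact sound (.smul_comp c g f))
    (by rintro ⟨g⟩ ⟨f⟩ ⟨f'⟩; exact sound (.comp_add g f f'))
    (by rintro c ⟨g⟩ ⟨f⟩; exact sound (.comp_smul c g f))

/-- Horizontal concatenation. -/
def tensor : DHom E v w →ₗ[𝕜] DHom E v' w' →ₗ[𝕜] DHom E (v ++ v') (w ++ w') :=
  LinearMap.mk₂ 𝕜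
    (Quot.map₂ Diagram.tensor (fun _ _ _ h => .tensor_congr (.refl _) h)
      (fun _ _ _ h => .tensor_congr h (.refl _)))
    (by rintro ⟨g⟩ ⟨g'⟩ ⟨f⟩; exact sound (.add_tensor g g' f))
    (by rintro c ⟨g⟩ ⟨f⟩; exact sound (.smul_tensor c g f))
    (by rintro ⟨g⟩ ⟨f⟩ ⟨f'⟩; exact sound (.tensor_add g f f'))
    (by rintro c ⟨g⟩ ⟨f⟩; exact sound (.tensor_smul c g f))

theorem comp_mk (g : Diagram 𝔥 v w) (f : Diagram 𝔥 u v) :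
    comp (mk E g) (mk E f) = mk E (Diagram.comp g f) := rfl

theorem tensor_mk (g : Diagram 𝔥 v w) (f : Diagram 𝔥 v' w') :
    tensor (mk E g) (mk E f) = mk E (Diagram.tensor g f) := rfl

theorem comp_assoc (h : DHom E w x) (g : DHom E v w) (f : DHom E u v) :
    comp (comp h g) f = comp h (comp g f) := by
  induction h using ind; induction g using ind; induction f using ind
  exact sound (.comp_assoc _ _ _)

theorem id_comp (f : DHom E v w) : comp (id E w) f = f := by
  induction f using ind; exact sound (.id_comp _)

theorem comp_id (f : DHom E v w) : comp f (id E v) = f := by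
  induction f using ind; exact sound (.comp_id _)

/-- The box `f`, as a linear function of `f`. -/
def box (E : LocalRel 𝔥) : SymmetricAlgebra 𝕜 (Module.Dual 𝕜 V) →ₗ[𝕜] DHom E [] [] where
  toFun f := mk E (Diagram.box f)
  map_add' f g := sound (.box_add f g)
  map_smul' c f := sound (.box_smul c f)

/-- Transport along equalities of boundary words. -/
def cast (hv : v = v') (hw : w = w') : DHom E v w →ₗ[𝕜] DHom E v' w' :=
  match hv, hw with
  | rfl, rfl => LinearMap.id

/-- The morphism `r ⋆ f`, with the box `r` to the left of `f`. -/
def boxLeft (r : SymmetricAlgebra 𝕜 (Module.Dual 𝕜 V)) : DHom E v w →ₗ[𝕜] DHom E v w :=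
  tensor (box E r)

/-- The morphism `f ⋆ r`, with the box `r` to the right of `f`. -/
def boxRight (r : SymmetricAlgebra 𝕜 (Module.Dual 𝕜 V)) : DHom E v w →ₗ[𝕜] DHom E v w :=
  cast (List.append_nil v) (List.append_nil w) ∘ₗ tensor.flip (box E r)

theorem boxLeft_add (r r' : SymmetricAlgebra 𝕜 (Module.Dual 𝕜 V)) (f : DHom E v w) :
    boxLeft (r + r') f = boxLeft r f + boxLeft r' f := by
  simp [boxLeft]

theorem boxLeft_smul (c : 𝕜) (r : SymmetricAlgebra 𝕜 (Module.Dual 𝕜 V)) (f : DHom E v w) :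
    boxLeft (c • r) f = c • boxLeft r f := by
  simp [boxLeft]

theorem boxLeft_comp (r : SymmetricAlgebra 𝕜 (Module.Dual 𝕜 V)) (g : DHom E v w)
    (f : DHom E u v) : boxLeft r (comp g f) = comp (boxLeft r g) f := by
  induction g using ind with | h g => ?_
  induction f using ind with | h f => ?_
  refine sound (.trans (.tensor_congr (.symm (.comp_id _)) (.refl _)) ?_)
  exact .trans (.interchange (Diagram.box r) (Diagram.id []) g f)
    (.comp_congr (.refl _) (.unit_tensor f))

theorem comp_boxLeft (r : SymmetricAlgebra 𝕜 (Module.Dual 𝕜 V)) (g : DHom E v w)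
    (f : DHom E u v) : comp g (boxLeft r f) = boxLeft r (comp g f) := by
  induction g using ind with | h g => ?_
  induction f using ind with | h f => ?_
  refine sound (.symm (.trans (.tensor_congr (.symm (.id_comp _)) (.refl _)) ?_))
  exact .trans (.interchange (Diagram.id []) (Diagram.box r) g f)
    (.comp_congr (.unit_tensor g) (.refl _))

/-- The morphisms of degree `n`, that is, the morphisms `B_v → B_w(n)`. -/
def deg (E : LocalRel 𝔥) (v w : List B) (n : ℤ) : Submodule 𝕜 (DHom E v w) where
  carrier := {f | ∃ d : Diagram 𝔥 v w, d.IsHomog n ∧ mk E d = f}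
  add_mem' := by
    rintro _ _ ⟨d, hd, rfl⟩ ⟨e, he, rfl⟩; exact ⟨_, .add hd he, rfl⟩
  zero_mem' := ⟨_, .zero n, rfl⟩
  smul_mem' := by
    rintro c _ ⟨d, hd, rfl⟩; exact ⟨_, .smul c hd, rfl⟩

theorem length_altWord (s t : B) (n : ℕ) : (altWord s t n).length = n := by
  induction n generalizing s t with
  | zero => rfl
  | succ n ih => simp [altWord, ih]

/-- A nonzero morphism `B_v → B_w` of degree `n` exists only if `n ≡ ℓ(v) + ℓ(w)` modulo `2`. -/
theorem mk_eq_zero_or_even {d : Diagram 𝔥 v w} {n : ℤ} (h : d.IsHomog n) :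
    mk E d = 0 ∨ Even (n + v.length + w.length) := by
  induction h with
  | zero n => exact .inl rfl
  | add _ _ h₁ h₂ =>
    rcases h₁ with h₁ | h₁
    · rcases h₂ with h₂ | h₂
      · left; rw [mk_add, h₁, h₂, add_zero]
      · exact .inr h₂
    · exact .inr h₁
  | smul c _ h =>
    rcases h with h | h
    · left; rw [mk_smul, h, smul_zero]
    · exact .inr h
  | id v => right; simp
  | comp _ _ h₁ h₂ =>
    rcases h₁ with h₁ | h₁
    · left; rw [← comp_mk, h₁, LinearMap.map_zero, LinearMap.zero_apply]
    · rcases h₂ with h₂ | h₂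
      · left; rw [← comp_mk, h₂, LinearMap.map_zero]
      · right; grind
  | tensor _ _ h₁ h₂ =>
    rcases h₁ with h₁ | h₁
    · left; rw [← tensor_mk, h₁, LinearMap.map_zero, LinearMap.zero_apply]
    · rcases h₂ with h₂ | h₂
      · left; rw [← tensor_mk, h₂, LinearMap.map_zero]
      · right; simp only [List.length_append, Nat.cast_add]; grind
  | box f k hf => right; simp
  | endDot s => right; exact ⟨1, by simp⟩
  | startDot s => right; exact ⟨1, by simp⟩
  | split s => right; exact ⟨1, by simp⟩
  | merge s => right; exact ⟨1, by simp⟩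
  | vertex s t hst hm => right; simp [length_altWord]

end DHom



/-! ## Sequences of objects of the additive hull -/

/-- A sequence of formal finite direct sums of shifted objects `B_w(n)`, almost all of them zero:
`term p` is the list of the pairs `(w, n)` of the summands `B_w(n)` in position `p`. -/
structure DSeq (B : Type*) where
  term : ℤ → List (List B × ℤ)
  finite_support : {p | term p ≠ []}.Finite

namespace DSeq

/-- The set of all summands. -/
abbrev Idx (F : DSeq B) : Type := Σ p : ℤ, Fin (F.term p).length

def pos (F : DSeq B) (a : F.Idx) : ℤ := a.1

def word (F : DSeq B) (a : F.Idx) : List B := ((F.term a.1).get a.2).1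

def shift (F : DSeq B) (a : F.Idx) : ℤ := ((F.term a.1).get a.2).2

theorem finite_idx (F : DSeq B) : Finite F.Idx := by
  have := F.finite_support.to_subtype
  refine Finite.of_injective
    (β := Σ p : {p | F.term p ≠ []}, Fin (F.term p).length)
    (fun a => ⟨⟨a.1, fun h => (Fin.cast (by simp [h]) a.2 : Fin 0).elim0⟩, a.2⟩) ?_
  rintro ⟨p, i⟩ ⟨q, j⟩ h
  obtain ⟨h₁, h₂⟩ := Sigma.mk.inj_iff.mp h
  obtain rfl : p = q := congrArg Subtype.val h₁
  exact congrArg (Sigma.mk p) (eq_of_heq h₂)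

noncomputable instance (F : DSeq B) : Fintype F.Idx :=
  have := F.finite_idx
  Fintype.ofFinite _

/-- The parity of a summand `B_w(n)` in position `p` is that of `ℓ(w) + n + p`. -/
def par (F : DSeq B) (a : F.Idx) : ℤ := (F.word a).length + F.shift a + F.pos a

end DSeq

section Complexes

variable (E : LocalRel 𝔥) {F G H K : DSeq B}

/-- The bigraded module of biequivariant morphisms `F → G`: matrices of morphisms between the
summands. Its bigrading is `BEHom.deg`. -/
abbrev BEHom (F G : DSeq B) : Type _ := ∀ (a : F.Idx) (b : G.Idx), DHom E (F.word a) (G.word b)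

namespace BEHom

/-- The part of bidegree `(i, j)`: a component from `B_w(n)` in position `p` to `B_v(m)` in
position `q` is a morphism `B_w(n) → B_v(m + j)`, and `q - p = i - j`. -/
def deg (F G : DSeq B) (i j : ℤ) : Submodule 𝕜 (BEHom E F G) where
  carrier := {f | ∀ a b,
    (G.pos b - F.pos a = i - j →
      f a b ∈ DHom.deg E (F.word a) (G.word b) (G.shift b + j - F.shift a)) ∧
    (G.pos b - F.pos a ≠ i - j → f a b = 0)}
  add_mem' hf hg a b :=
    ⟨fun h => add_mem ((hf a b).1 h) ((hg a b).1 h), fun h => by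
      simp [(hf a b).2 h, (hg a b).2 h]⟩
  zero_mem' _ _ := ⟨fun _ => zero_mem _, fun _ => rfl⟩
  smul_mem' c _ hf a b :=
    ⟨fun h => Submodule.smul_mem _ c ((hf a b).1 h), fun h => by simp [(hf a b).2 h]⟩

variable {E}

noncomputable def comp : BEHom E G H →ₗ[𝕜] BEHom E F G →ₗ[𝕜] BEHom E F H :=
  LinearMap.mk₂ 𝕜 (fun g f a c => ∑ b, DHom.comp (g b c) (f a b))
    (fun _ _ _ => by ext a c; simp [Finset.sum_add_distrib])
    (fun _ _ _ => by ext a c; simp [Finset.smul_sum])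
    (fun _ _ _ => by ext a c; simp [Finset.sum_add_distrib])
    (fun _ _ _ => by ext a c; simp [Finset.smul_sum])

theorem comp_apply (g : BEHom E G H) (f : BEHom E F G) (a : F.Idx) (c : H.Idx) :
    comp g f a c = ∑ b, DHom.comp (g b c) (f a b) := rfl

theorem comp_assoc (h : BEHom E H K) (g : BEHom E G H) (f : BEHom E F G) :
    comp (comp h g) f = comp h (comp g f) := by
  ext a c
  simp only [comp_apply, map_sum, LinearMap.sum_apply, DHom.comp_assoc]
  exact Finset.sum_comm

variable (E) in
def id (F : DSeq B) : BEHom E F F := fun a b =>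
  if h : a = b then h ▸ DHom.id E (F.word a) else 0

theorem id_comp (f : BEHom E F G) : comp (id E G) f = f := by
  ext a c
  rw [comp_apply, Finset.sum_eq_single c]
  · simp [id, DHom.id_comp]
  · intro b _ hb; simp [id, hb]
  · simp

theorem comp_id (f : BEHom E F G) : comp f (id E F) = f := by
  ext a c
  rw [comp_apply, Finset.sum_eq_single a]
  · simp [id, DHom.comp_id]
  · intro b _ hb; simp [id, Ne.symm hb]
  · simp

/-- Convolution `r ⋆ f` with an element `r` of `R = End(B_∅)`. The sign in the convolution of
morphisms is `+1` here, because `r` is in even degree. -/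
def boxLeft (r : SymmetricAlgebra 𝕜 (Module.Dual 𝕜 V)) : BEHom E F G →ₗ[𝕜] BEHom E F G where
  toFun f a b := DHom.boxLeft r (f a b)
  map_add' _ _ := by ext; simp
  map_smul' _ _ := by ext; simp

/-- Convolution `f ⋆ r` with an element `r` of `R = End(B_∅)`. The sign in the convolution of
morphisms is `+1` here, because `r` is in even degree. -/
def boxRight (r : SymmetricAlgebra 𝕜 (Module.Dual 𝕜 V)) : BEHom E F G →ₗ[𝕜] BEHom E F G where
  toFun f a b := DHom.boxRight r (f a b)
  map_add' _ _ := by ext; simp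
  map_smul' _ _ := by ext; simp

theorem boxLeft_comp (r : SymmetricAlgebra 𝕜 (Module.Dual 𝕜 V)) (g : BEHom E G H)
    (f : BEHom E F G) : boxLeft r (comp g f) = comp (boxLeft r g) f := by
  ext a c
  simp [boxLeft, comp_apply, DHom.boxLeft_comp]

theorem comp_boxLeft (r : SymmetricAlgebra 𝕜 (Module.Dual 𝕜 V)) (g : BEHom E G H)
    (f : BEHom E F G) : comp g (boxLeft r f) = boxLeft r (comp g f) := by
  ext a c
  simp [boxLeft, comp_apply, DHom.comp_boxLeft]

/-- The components of even cohomological degree, see `even_of_mem_deg`. -/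
def even : BEHom E F G →ₗ[𝕜] BEHom E F G where
  toFun f a b := if Even (F.par a + G.par b) then f a b else 0
  map_add' _ _ := by ext; simp only [Pi.add_apply]; split_ifs <;> simp
  map_smul' _ _ := by ext; simp

/-- The components of odd cohomological degree, see `odd_of_mem_deg`. -/
def odd : BEHom E F G →ₗ[𝕜] BEHom E F G where
  toFun f a b := if Even (F.par a + G.par b) then 0 else f a b
  map_add' _ _ := by ext; simp only [Pi.add_apply]; split_ifs <;> simp
  map_smul' _ _ := by ext; simp

theorem even_apply (f : BEHom E F G) (a : F.Idx) (b : G.Idx) :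
    even f a b = if Even (F.par a + G.par b) then f a b else 0 := rfl

theorem odd_apply (f : BEHom E F G) (a : F.Idx) (b : G.Idx) :
    odd f a b = if Even (F.par a + G.par b) then 0 else f a b := rfl

theorem eq_zero_of_mem_deg {f : BEHom E F G} {i j : ℤ} (hf : f ∈ deg E F G i j)
    {a : F.Idx} {b : G.Idx} (h : ¬ Even (F.par a + G.par b + i)) : f a b = 0 := by
  by_cases hp : G.pos b - F.pos a = i - j
  · obtain ⟨d, hd, hfd⟩ := (hf a b).1 hp
    rcases DHom.mk_eq_zero_or_even (E := E) hd with h0 | h0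
    · rw [← hfd, h0]
    · exfalso; apply h
      simp only [DSeq.par]
      grind
  · exact (hf a b).2 hp

theorem even_of_mem_deg {f : BEHom E F G} {i j : ℤ} (hf : f ∈ deg E F G i j) :
    even f = if Even i then f else 0 := by
  ext a b
  have := eq_zero_of_mem_deg hf (a := a) (b := b)
  rw [even_apply]
  split_ifs with h₁ h₂ h₂
  · rfl
  · exact this (by grind)
  · exact (this (by grind)).symm
  · rfl

theorem odd_of_mem_deg {f : BEHom E F G} {i j : ℤ} (hf : f ∈ deg E F G i j) :
    odd f = if Even i then 0 else f := by
  ext a b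
  have := eq_zero_of_mem_deg hf (a := a) (b := b)
  rw [odd_apply]
  split_ifs with h₁ h₂ h₂
  · rfl
  · exact (this (by grind)).symm
  · exact this (by grind)
  · rfl

theorem even_add_odd (f : BEHom E F G) : even f + odd f = f := by
  ext a b; simp only [Pi.add_apply, even_apply, odd_apply]; split_ifs <;> simp

theorem even_even (f : BEHom E F G) : even (even f) = even f := by
  ext a b; simp only [even_apply]; split_ifs <;> rfl

theorem odd_odd (f : BEHom E F G) : odd (odd f) = odd f := by
  ext a b; simp only [odd_apply]; split_ifs <;> rfl

theorem even_odd (f : BEHom E F G) : even (odd f) = 0 := by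
  ext a b; simp only [even_apply, odd_apply]; split_ifs <;> rfl

theorem odd_even (f : BEHom E F G) : odd (even f) = 0 := by
  ext a b; simp only [even_apply, odd_apply]; split_ifs <;> rfl

theorem even_comp (g : BEHom E G H) (f : BEHom E F G) :
    even (comp g f) = comp (even g) (even f) + comp (odd g) (odd f) := by
  ext a c
  simp only [Pi.add_apply, even_apply, odd_apply, comp_apply, ← Finset.sum_add_distrib]
  by_cases h : Even (F.par a + H.par c)
  · rw [if_pos h]
    refine Finset.sum_congr rfl fun b _ => ?_
    by_cases h₁ : Even (F.par a + G.par b)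
    · have h₂ : Even (G.par b + H.par c) := by grind
      simp [h₁, h₂]
    · have h₂ : ¬ Even (G.par b + H.par c) := by grind
      simp [h₁, h₂]
  · rw [if_neg h]
    refine (Finset.sum_eq_zero fun b _ => ?_).symm
    by_cases h₁ : Even (F.par a + G.par b)
    · have h₂ : ¬ Even (G.par b + H.par c) := by grind
      simp [h₁, h₂]
    · have h₂ : Even (G.par b + H.par c) := by grind
      simp [h₁, h₂]

theorem odd_comp (g : BEHom E G H) (f : BEHom E F G) :
    odd (comp g f) = comp (even g) (odd f) + comp (odd g) (even f) := by
  have h₀ : odd (comp g f) = comp g f - even (comp g f) :=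
    eq_sub_of_add_eq' (even_add_odd _)
  have h' : comp g f = comp (even g + odd g) (even f + odd f) := by
    rw [even_add_odd, even_add_odd]
  rw [h₀, even_comp, h']
  simp only [map_add, LinearMap.add_apply]
  abel

theorem even_boxLeft (r : SymmetricAlgebra 𝕜 (Module.Dual 𝕜 V)) (f : BEHom E F G) :
    even (boxLeft r f) = boxLeft r (even f) := by
  ext a b; simp only [even_apply, boxLeft, LinearMap.coe_mk, AddHom.coe_mk]; split_ifs <;> simp

theorem odd_boxLeft (r : SymmetricAlgebra 𝕜 (Module.Dual 𝕜 V)) (f : BEHom E F G) :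
    odd (boxLeft r f) = boxLeft r (odd f) := by
  ext a b; simp only [odd_apply, boxLeft, LinearMap.coe_mk, AddHom.coe_mk]; split_ifs <;> simp

theorem even_id : even (id E F) = id E F := by
  ext a b
  simp only [even_apply]
  split_ifs with h
  · rfl
  · have : a ≠ b := by
      rintro rfl; exact h ⟨F.par a, rfl⟩
    simp [id, this]

theorem odd_id : odd (id E F) = 0 := by
  rw [← even_id, odd_even]

end BEHom

/-! ## Free-monodromic complexes -/

open scoped TensorProduct

theorem contractLeft_mul (d : Module.Dual 𝕜 (Module.Dual 𝕜 V))
    (a b : ExteriorAlgebra 𝕜 (Module.Dual 𝕜 V)) :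
    CliffordAlgebra.contractLeft d (a * b) =
      CliffordAlgebra.contractLeft d a * b +
        CliffordAlgebra.involute a * CliffordAlgebra.contractLeft d b := by
  induction a using CliffordAlgebra.left_induction with
  | algebraMap r => simp [CliffordAlgebra.contractLeft_algebraMap_mul]
  | add x y hx hy => simp only [add_mul, map_add, hx, hy]; abel
  | ι_mul x m hx =>
    rw [mul_assoc, CliffordAlgebra.contractLeft_ι_mul, hx, CliffordAlgebra.contractLeft_ι_mul,
      map_mul, CliffordAlgebra.involute_ι]
    simp only [mul_add, sub_mul, smul_mul_assoc, neg_mul, mul_assoc]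
    abel

theorem contractLeft_involute (d : Module.Dual 𝕜 (Module.Dual 𝕜 V))
    (a : ExteriorAlgebra 𝕜 (Module.Dual 𝕜 V)) :
    CliffordAlgebra.contractLeft d (CliffordAlgebra.involute a) =
      -CliffordAlgebra.involute (CliffordAlgebra.contractLeft d a) := by
  induction a using CliffordAlgebra.left_induction with
  | algebraMap r => simp
  | add x y hx hy => simp only [map_add, hx, hy, neg_add]
  | ι_mul x m hx =>
    simp only [map_mul, CliffordAlgebra.involute_ι, neg_mul, map_neg,
      CliffordAlgebra.contractLeft_ι_mul, hx, map_sub, map_smul, mul_neg]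

/-- The bigraded module `Λ ⊗ Hom_BE(F, G) ⊗ R^∨`, where `Λ` is the exterior algebra of `V^*` and
`R^∨` is the symmetric algebra of `V`. Its bigrading is `FMHom.deg`. -/
abbrev FMHom (F G : DSeq B) : Type _ :=
  ExteriorAlgebra 𝕜 (Module.Dual 𝕜 V) ⊗[𝕜] (BEHom E F G ⊗[𝕜] SymmetricAlgebra 𝕜 V)

namespace FMHom

/-- The part of bidegree `(i, j)`, where `V^* ⊆ Λ` is in bidegree `(1, 2)` and `V ⊆ R^∨` is in
bidegree `(0, -2)`. -/
def deg (F G : DSeq B) (i j : ℤ) : Submodule 𝕜 (FMHom E F G) :=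
  Submodule.span 𝕜 {z | ∃ (k l : ℕ) (a b : ℤ), k + a = i ∧ 2 * k + b - 2 * l = j ∧
    ∃ r ∈ ⋀[𝕜]^k (Module.Dual 𝕜 V), ∃ f ∈ BEHom.deg E F G a b, ∃ x ∈ symDeg 𝕜 V l,
      z = r ⊗ₜ (f ⊗ₜ x)}

variable {E}

theorem ind {p : FMHom E F G → Prop} (z : FMHom E F G) (h0 : p 0)
    (ht : ∀ r f x, p (r ⊗ₜ (f ⊗ₜ x))) (ha : ∀ a b, p a → p b → p (a + b)) : p z := by
  induction z using TensorProduct.induction_on with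
  | zero => exact h0
  | add a b hx hy => exact ha a b hx hy
  | tmul r y =>
    induction y using TensorProduct.induction_on with
    | zero => rw [TensorProduct.tmul_zero]; exact h0
    | add a b hx hy => rw [TensorProduct.tmul_add]; exact ha _ _ hx hy
    | tmul f x => exact ht r f x

/-- The linear map `r ⊗ f ⊗ x ↦ A(r) ⊗ P(f) ⊗ x`. -/
noncomputable def mapLam
    (A : ExteriorAlgebra 𝕜 (Module.Dual 𝕜 V) →ₗ[𝕜] ExteriorAlgebra 𝕜 (Module.Dual 𝕜 V))
    (P : BEHom E F G →ₗ[𝕜] BEHom E F G) : FMHom E F G →ₗ[𝕜] FMHom E F G :=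
  TensorProduct.map A (TensorProduct.map P LinearMap.id)

theorem mapLam_tmul
    (A : ExteriorAlgebra 𝕜 (Module.Dual 𝕜 V) →ₗ[𝕜] ExteriorAlgebra 𝕜 (Module.Dual 𝕜 V))
    (P : BEHom E F G →ₗ[𝕜] BEHom E F G) (r : ExteriorAlgebra 𝕜 (Module.Dual 𝕜 V))
    (f : BEHom E F G) (x : SymmetricAlgebra 𝕜 V) :
    mapLam A P (r ⊗ₜ (f ⊗ₜ x)) = A r ⊗ₜ (P f ⊗ₜ x) := rfl

/-- The linear map `r ↦ (-1)^{|r|} r`. -/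
def lamSgn : ExteriorAlgebra 𝕜 (Module.Dual 𝕜 V) →ₗ[𝕜] ExteriorAlgebra 𝕜 (Module.Dual 𝕜 V) :=
  CliffordAlgebra.involute.toLinearMap

theorem lamSgn_apply (r : ExteriorAlgebra 𝕜 (Module.Dual 𝕜 V)) :
    lamSgn r = CliffordAlgebra.involute r := rfl

/-- The operator `z ↦ (-1)^{|z|} z`, where `|z|` is the cohomological degree. -/
noncomputable def sgn : FMHom E F G →ₗ[𝕜] FMHom E F G :=
  mapLam lamSgn (BEHom.even - BEHom.odd)

theorem sgn_tmul (r : ExteriorAlgebra 𝕜 (Module.Dual 𝕜 V))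
    (f : BEHom E F G) (x : SymmetricAlgebra 𝕜 V) :
    sgn (r ⊗ₜ[𝕜] (f ⊗ₜ[𝕜] x)) =
      CliffordAlgebra.involute r ⊗ₜ[𝕜] ((BEHom.even f - BEHom.odd f) ⊗ₜ[𝕜] x) := rfl

/-- Composition without signs, `(r ⊗ f ⊗ x)(s ⊗ g ⊗ y) = rs ⊗ fg ⊗ xy`. -/
noncomputable def rawComp : FMHom E G H →ₗ[𝕜] FMHom E F G →ₗ[𝕜] FMHom E F H :=
  TensorProduct.map₂ (LinearMap.mul 𝕜 (ExteriorAlgebra 𝕜 (Module.Dual 𝕜 V)))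
    (TensorProduct.map₂ BEHom.comp (LinearMap.mul 𝕜 (SymmetricAlgebra 𝕜 V)))

/-- Composition, `(r ⊗ f ⊗ x) ∘ (s ⊗ g ⊗ y) = (-1)^{|f||s|} rs ⊗ fg ⊗ xy`. -/
noncomputable def comp : FMHom E G H →ₗ[𝕜] FMHom E F G →ₗ[𝕜] FMHom E F H :=
  rawComp ∘ₗ mapLam LinearMap.id BEHom.even +
    rawComp.compl₁₂ (mapLam LinearMap.id BEHom.odd) (mapLam lamSgn LinearMap.id)

theorem comp_tmul (r s : ExteriorAlgebra 𝕜 (Module.Dual 𝕜 V)) (f : BEHom E G H)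
    (g : BEHom E F G) (x y : SymmetricAlgebra 𝕜 V) :
    comp (r ⊗ₜ[𝕜] (f ⊗ₜ[𝕜] x)) (s ⊗ₜ[𝕜] (g ⊗ₜ[𝕜] y)) =
      (r * s) ⊗ₜ[𝕜] (BEHom.comp (BEHom.even f) g ⊗ₜ[𝕜] (x * y)) +
      (r * CliffordAlgebra.involute s) ⊗ₜ[𝕜] (BEHom.comp (BEHom.odd f) g ⊗ₜ[𝕜] (x * y)) := rfl

theorem comp_assoc (h : FMHom E H K) (g : FMHom E G H) (f : FMHom E F G) :
    comp (comp h g) f = comp h (comp g f) := by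
  induction h using ind with
  | h0 => simp
  | ha a b ha hb => simp only [map_add, LinearMap.add_apply, ha, hb]
  | ht r₁ f₁ x₁ =>
  induction g using ind with
  | h0 => simp
  | ha a b ha hb => simp only [map_add, LinearMap.add_apply, ha, hb]
  | ht r₂ f₂ x₂ =>
  induction f using ind with
  | h0 => simp
  | ha a b ha hb => simp only [map_add, ha, hb]
  | ht r₃ f₃ x₃ =>
  simp only [comp_tmul, map_add, LinearMap.add_apply, BEHom.even_comp, BEHom.odd_comp,
    BEHom.even_even, BEHom.even_odd, BEHom.odd_even, BEHom.odd_odd, map_zero,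
    LinearMap.zero_apply, add_zero, zero_add, BEHom.comp_assoc, mul_assoc, map_mul, CliffordAlgebra.involute_involute]
  abel

variable (E) in
noncomputable def id (F : DSeq B) : FMHom E F F := 1 ⊗ₜ (BEHom.id E F ⊗ₜ 1)

theorem id_comp (f : FMHom E F G) : comp (id E G) f = f := by
  induction f using ind with
  | h0 => simp
  | ha a b ha hb => simp only [map_add, ha, hb]
  | ht r f x =>
    simp [id, comp_tmul, BEHom.even_id, BEHom.odd_id, BEHom.id_comp]

theorem comp_id (f : FMHom E F G) : comp f (id E F) = f := by
  induction f using ind with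
  | h0 => simp
  | ha a b ha hb => simp only [map_add, LinearMap.add_apply, ha, hb]
  | ht r f x =>
    simp only [id, comp_tmul, map_one, mul_one, BEHom.comp_id]
    rw [← TensorProduct.tmul_add, ← TensorProduct.add_tmul, BEHom.even_add_odd]

theorem sgn_comp (g : FMHom E G H) (f : FMHom E F G) :
    sgn (comp g f) = comp (sgn g) (sgn f) := by
  induction g using ind with
  | h0 => simp
  | ha a b ha hb => simp only [map_add, LinearMap.add_apply, ha, hb]
  | ht r₁ f₁ x₁ =>
  induction f using ind with
  | h0 => simp
  | ha a b ha hb => simp only [map_add, ha, hb]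
  | ht r₂ f₂ x₂ =>
  simp only [comp_tmul, sgn_tmul, map_add, map_sub, LinearMap.sub_apply, BEHom.even_comp,
    BEHom.odd_comp, BEHom.even_even, BEHom.even_odd, BEHom.odd_even, BEHom.odd_odd, map_zero,
    LinearMap.zero_apply, TensorProduct.tmul_zero, TensorProduct.zero_tmul, add_zero, zero_add,
    map_mul, CliffordAlgebra.involute_involute, TensorProduct.sub_tmul, TensorProduct.tmul_sub]
  abel

theorem sgn_sgn (f : FMHom E F G) : sgn (sgn f) = f := by
  induction f using ind with
  | h0 => simp
  | ha a b ha hb => simp only [map_add, ha, hb]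
  | ht r f x =>
    simp only [sgn_tmul, map_sub, BEHom.even_even, BEHom.even_odd, BEHom.odd_even, BEHom.odd_odd,
      CliffordAlgebra.involute_involute, sub_zero, zero_sub, sub_neg_eq_add, BEHom.even_add_odd]

theorem sgn_id : sgn (id E F) = id E F := by
  simp [id, sgn_tmul, BEHom.even_id, BEHom.odd_id]

theorem involute_of_mem {k : ℕ} {r : ExteriorAlgebra 𝕜 (Module.Dual 𝕜 V)}
    (hr : r ∈ ⋀[𝕜]^k (Module.Dual 𝕜 V)) : CliffordAlgebra.involute r = (-1 : 𝕜) ^ k • r := by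
  induction hr using Submodule.pow_induction_on_left' with
  | algebraMap r => simp
  | add x y i hx hy h₁ h₂ => rw [map_add, h₁, h₂, smul_add]
  | mem_mul m hm i x hx h =>
    obtain ⟨v, rfl⟩ := hm
    rw [map_mul, h, CliffordAlgebra.involute_ι, pow_succ]
    simp

theorem sgn_of_mem_deg {z : FMHom E F G} {i j : ℤ} (hz : z ∈ deg E F G i j) :
    sgn z = if Even i then z else -z := by
  induction hz using Submodule.span_induction with
  | mem z h =>
    obtain ⟨k, l, a, b, rfl, rfl, r, hr, f, hf, x, hx, rfl⟩ := h
    rw [sgn_tmul, involute_of_mem hr, BEHom.even_of_mem_deg hf, BEHom.odd_of_mem_deg hf]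
    rcases Nat.even_or_odd k with hk | hk <;> rcases Int.even_or_odd a with ha | ha
    · have : Even ((k : ℤ) + a) := by grind
      simp [hk.neg_one_pow, ha, this]
    · have h₁ : ¬ Even ((k : ℤ) + a) := by grind
      have h₂ : ¬ Even a := by grind
      simp [hk.neg_one_pow, h₁, h₂, TensorProduct.neg_tmul, TensorProduct.tmul_neg]
    · have h₁ : ¬ Even ((k : ℤ) + a) := by grind
      simp [hk.neg_one_pow, h₁, ha, TensorProduct.neg_tmul]
    · have h₁ : Even ((k : ℤ) + a) := by grind
      have h₂ : ¬ Even a := by grind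
      simp [hk.neg_one_pow, h₁, h₂, TensorProduct.neg_tmul, TensorProduct.tmul_neg]
  | zero => simp
  | add a b _ _ ha hb => rw [map_add, ha, hb]; split_ifs <;> abel
  | smul c a _ ha => rw [map_smul, ha]; split_ifs <;> simp

/-- The contraction `x ⌢ (r ⊗ f ⊗ y) = (x ⌢ r) ⊗ f ⊗ y` with `x ∈ V`. -/
noncomputable def contract (x : V) : FMHom E F G →ₗ[𝕜] FMHom E F G :=
  mapLam (CliffordAlgebra.contractLeft (Module.Dual.eval 𝕜 V x)) LinearMap.id

/-- The right action `(r ⊗ f ⊗ x) · y = r ⊗ f ⊗ xy` of `R^∨`. -/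
noncomputable def rightMul (y : SymmetricAlgebra 𝕜 V) : FMHom E F G →ₗ[𝕜] FMHom E F G :=
  TensorProduct.map LinearMap.id
    (TensorProduct.map LinearMap.id (LinearMap.mulRight 𝕜 y))

section Koszul

variable [Module.Free 𝕜 V] [Module.Finite 𝕜 V]

/-- The Koszul differential `r ⊗ f ⊗ x ↦ ∑ᵢ (ěᵢ ⌢ r) ⊗ (eᵢ ⋆ f) ⊗ x`, for a basis `(ěᵢ)` of `V`
with dual basis `(eᵢ)`; see `kappa_one` and `kappa_ι_mul` for its explicit form. -/
noncomputable def kappa : FMHom E F G →ₗ[𝕜] FMHom E F G :=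
  ∑ i, mapLam
    (CliffordAlgebra.contractLeft (Module.Dual.eval 𝕜 V (Module.Free.chooseBasis 𝕜 V i)))
    (BEHom.boxLeft (SymmetricAlgebra.ι 𝕜 (Module.Dual 𝕜 V)
      ((Module.Free.chooseBasis 𝕜 V).coord i)))

theorem kappa_tmul (r : ExteriorAlgebra 𝕜 (Module.Dual 𝕜 V))
    (f : BEHom E F G) (x : SymmetricAlgebra 𝕜 V) :
    kappa (r ⊗ₜ[𝕜] (f ⊗ₜ[𝕜] x)) = ∑ i,
      CliffordAlgebra.contractLeft (Module.Dual.eval 𝕜 V (Module.Free.chooseBasis 𝕜 V i)) r ⊗ₜ[𝕜]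
        (BEHom.boxLeft (SymmetricAlgebra.ι 𝕜 (Module.Dual 𝕜 V)
          ((Module.Free.chooseBasis 𝕜 V).coord i)) f ⊗ₜ[𝕜] x) := by
  simp only [kappa, LinearMap.sum_apply, mapLam_tmul]

theorem kappa_one (f : BEHom E F G) (x : SymmetricAlgebra 𝕜 V) :
    kappa ((1 : ExteriorAlgebra 𝕜 (Module.Dual 𝕜 V)) ⊗ₜ[𝕜] (f ⊗ₜ[𝕜] x)) = 0 := by
  simp [kappa_tmul]

theorem boxLeft_sum_coord (v : Module.Dual 𝕜 V) (f : BEHom E F G) :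
    ∑ i, v (Module.Free.chooseBasis 𝕜 V i) •
      BEHom.boxLeft (SymmetricAlgebra.ι 𝕜 (Module.Dual 𝕜 V)
        ((Module.Free.chooseBasis 𝕜 V).coord i)) f =
      BEHom.boxLeft (SymmetricAlgebra.ι 𝕜 (Module.Dual 𝕜 V) v) f := by
  have hv : v = ∑ i, v (Module.Free.chooseBasis 𝕜 V i) • (Module.Free.chooseBasis 𝕜 V).coord i :=
    ((Module.Free.chooseBasis 𝕜 V).sum_dual_apply_smul_coord v).symm
  ext a b
  conv_rhs => rw [hv]
  simp only [Finset.sum_apply, Pi.smul_apply, BEHom.boxLeft, LinearMap.coe_mk, AddHom.coe_mk,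
    map_sum, map_smul, DHom.boxLeft, LinearMap.sum_apply, LinearMap.smul_apply]

theorem kappa_ι_mul (v : Module.Dual 𝕜 V) (r : ExteriorAlgebra 𝕜 (Module.Dual 𝕜 V))
    (f : BEHom E F G) (x : SymmetricAlgebra 𝕜 V) :
    kappa ((ExteriorAlgebra.ι 𝕜 v * r) ⊗ₜ[𝕜] (f ⊗ₜ[𝕜] x)) =
      r ⊗ₜ[𝕜] (BEHom.boxLeft (SymmetricAlgebra.ι 𝕜 (Module.Dual 𝕜 V) v) f ⊗ₜ[𝕜] x) -
        comp (ExteriorAlgebra.ι 𝕜 v ⊗ₜ[𝕜] (BEHom.id E G ⊗ₜ[𝕜] 1))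
          (kappa (r ⊗ₜ[𝕜] (f ⊗ₜ[𝕜] x))) := by
  rw [← boxLeft_sum_coord, kappa_tmul, kappa_tmul, map_sum, TensorProduct.sum_tmul,
    TensorProduct.tmul_sum, ← Finset.sum_sub_distrib]
  refine Finset.sum_congr rfl fun i _ => ?_
  rw [CliffordAlgebra.contractLeft_ι_mul, comp_tmul, BEHom.even_id, BEHom.odd_id, BEHom.id_comp]
  simp [TensorProduct.sub_tmul, TensorProduct.smul_tmul]

theorem kappa_comp (g : FMHom E G H) (f : FMHom E F G) :
    kappa (comp g f) = comp (kappa g) f + comp (sgn g) (kappa f) := by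
  induction g using ind with
  | h0 => simp
  | ha a b ha hb => simp only [map_add, LinearMap.add_apply, ha, hb]; abel
  | ht r₁ f₁ x₁ =>
  induction f using ind with
  | h0 => simp
  | ha a b ha hb => simp only [map_add, ha, hb]; abel
  | ht r₂ f₂ x₂ =>
  simp only [comp_tmul, kappa_tmul, sgn_tmul, map_add, map_sum, LinearMap.sum_apply,
    ← Finset.sum_add_distrib]
  refine Finset.sum_congr rfl fun i _ => ?_
  simp only [contractLeft_mul, contractLeft_involute, map_sub, BEHom.even_even, BEHom.even_odd,
    BEHom.odd_even, BEHom.odd_odd, BEHom.even_boxLeft, BEHom.odd_boxLeft, BEHom.boxLeft_comp,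
    sub_zero, zero_sub, map_neg, LinearMap.neg_apply, TensorProduct.neg_tmul,
    TensorProduct.tmul_neg, TensorProduct.add_tmul, mul_neg, BEHom.comp_boxLeft]
  abel

theorem kappa_sgn (f : FMHom E F G) : kappa (sgn f) = -sgn (kappa f) := by
  induction f using ind with
  | h0 => simp
  | ha a b ha hb => simp only [map_add, ha, hb]; abel
  | ht r f x =>
    simp only [sgn_tmul, kappa_tmul, map_sum, ← Finset.sum_neg_distrib, contractLeft_involute,
      map_sub, BEHom.even_boxLeft, BEHom.odd_boxLeft, TensorProduct.neg_tmul]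

variable (E) in
/-- The element `Θ = ∑ᵢ 1 ⊗ (id ⋆ eᵢ) ⊗ ěᵢ`, for a basis `(ěᵢ)` of `V` with dual basis `(eᵢ)`. -/
noncomputable def Theta (F : DSeq B) : FMHom E F F :=
  ∑ i, 1 ⊗ₜ (BEHom.boxRight (SymmetricAlgebra.ι 𝕜 (Module.Dual 𝕜 V)
      ((Module.Free.chooseBasis 𝕜 V).coord i)) (BEHom.id E F) ⊗ₜ
    SymmetricAlgebra.ι 𝕜 V (Module.Free.chooseBasis 𝕜 V i))

end Koszul

end FMHom

variable [Module.Free 𝕜 V] [Module.Finite 𝕜 V]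

/-- Free-monodromic complexes. -/
structure FMObj where
  seq : DSeq B
  δ : FMHom E seq seq
  δ_mem : δ ∈ FMHom.deg E seq seq 1 0
  δ_comp_δ : FMHom.comp δ δ + FMHom.kappa δ = FMHom.Theta E seq

variable {E}

namespace FMObj

/-- The differential `f ↦ κ(f) + δ_G ∘ f - (-1)^{|f|} f ∘ δ_F` of the complex of morphisms. -/
noncomputable def diff (F G : FMObj E) : FMHom E F.seq G.seq →ₗ[𝕜] FMHom E F.seq G.seq :=
  FMHom.kappa + FMHom.comp G.δ - FMHom.comp.flip F.δ ∘ₗ FMHom.sgn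

theorem diff_apply (F G : FMObj E) (f : FMHom E F.seq G.seq) :
    diff F G f = FMHom.kappa f + FMHom.comp G.δ f - FMHom.comp (FMHom.sgn f) F.δ := rfl

theorem sgn_δ (F : FMObj E) : FMHom.sgn F.δ = -F.δ := by
  simp [FMHom.sgn_of_mem_deg F.δ_mem]

theorem diff_comp {F G H : FMObj E} (g : FMHom E G.seq H.seq) (f : FMHom E F.seq G.seq) :
    diff F H (FMHom.comp g f) =
      FMHom.comp (diff G H g) f + FMHom.comp (FMHom.sgn g) (diff F G f) := by
  simp only [diff_apply, FMHom.kappa_comp, FMHom.sgn_comp, map_add, map_sub, LinearMap.add_apply,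
    LinearMap.sub_apply, FMHom.comp_assoc]
  abel

theorem diff_sgn {F G : FMObj E} (f : FMHom E F.seq G.seq) :
    diff F G (FMHom.sgn f) = -FMHom.sgn (diff F G f) := by
  simp only [diff_apply, FMHom.kappa_sgn, map_add, map_sub, FMHom.sgn_comp, sgn_δ,
    FMHom.sgn_sgn, map_neg, LinearMap.neg_apply]
  abel

theorem diff_id (F : FMObj E) : diff F F (FMHom.id E F.seq) = 0 := by
  rw [diff_apply, FMHom.sgn_id, FMHom.comp_id, FMHom.id_comp, FMHom.id, FMHom.kappa_one]
  abel

end FMObj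

/-- The cohomology of the complex of morphisms `F → G`. Its bigrading is `gHom.deg`. -/
abbrev gHom (F G : FMObj E) : Type _ := Cohomology (FMObj.diff F G)

namespace gHom

variable {F G H K : FMObj E}

/-- The class of a cocycle. -/
noncomputable abbrev mk (f : FMHom E F.seq G.seq) (hf : FMObj.diff F G f = 0) : gHom F G :=
  Cohomology.mk f hf

/-- The part of bidegree `(i, j)`: the classes of the cocycles of bidegree `(i, j)`. -/
noncomputable def deg (F G : FMObj E) (i j : ℤ) : Submodule 𝕜 (gHom F G) :=
  Cohomology.classes _ (FMHom.deg E F.seq G.seq i j)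

theorem diff_comp_eq_zero (g : FMHom E G.seq H.seq) (f : FMHom E F.seq G.seq)
    (hg : FMObj.diff G H g = 0) (hf : FMObj.diff F G f = 0) :
    FMObj.diff F H (FMHom.comp g f) = 0 := by
  rw [FMObj.diff_comp, hg, hf, map_zero, map_zero, LinearMap.zero_apply, add_zero]

/-- Composition of cohomology classes. -/
noncomputable def comp : gHom G H →ₗ[𝕜] gHom F G →ₗ[𝕜] gHom F H :=
  Cohomology.map₂ FMHom.comp diff_comp_eq_zero
    (fun h f hf => ⟨FMHom.comp h f, by rw [FMObj.diff_comp, hf, map_zero, add_zero]⟩)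
    (fun g h hg => ⟨FMHom.comp (FMHom.sgn g) h, by
      rw [FMObj.diff_comp, FMObj.diff_sgn, hg, FMHom.sgn_sgn, map_zero, neg_zero, map_zero,
        LinearMap.zero_apply, zero_add]⟩)

theorem comp_mk (g : FMHom E G.seq H.seq) (hg : FMObj.diff G H g = 0)
    (f : FMHom E F.seq G.seq) (hf : FMObj.diff F G f = 0) :
    comp (mk g hg) (mk f hf) = mk (FMHom.comp g f) (diff_comp_eq_zero g f hg hf) := rfl

theorem comp_assoc (h : gHom H K) (g : gHom G H) (f : gHom F G) :
    comp (comp h g) f = comp h (comp g f) := by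
  induction h using Cohomology.ind
  induction g using Cohomology.ind
  induction f using Cohomology.ind
  simp only [comp_mk, FMHom.comp_assoc]

noncomputable instance : One (gHom F F) := ⟨gHom.mk (FMHom.id E F.seq) (FMObj.diff_id F)⟩

noncomputable instance : Mul (gHom F F) := ⟨fun g f => comp g f⟩

theorem one_def : (1 : gHom F F) = mk (FMHom.id E F.seq) (FMObj.diff_id F) := rfl

theorem mul_def (g f : gHom F F) : g * f = comp g f := rfl

theorem one_comp (f : gHom F G) : comp 1 f = f := by
  induction f using Cohomology.ind
  simp only [one_def, comp_mk, FMHom.id_comp]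

theorem comp_one (f : gHom F G) : comp f 1 = f := by
  induction f using Cohomology.ind
  simp only [one_def, comp_mk, FMHom.comp_id]

/-- The algebra `gEnd(F)`, in which the product is the composition. -/
noncomputable instance : Ring (gHom F F) where
  __ := (inferInstance : AddCommGroup (gHom F F))
  mul_assoc := comp_assoc
  one_mul := one_comp
  mul_one := comp_one
  left_distrib g f f' := map_add (comp g) f f'
  right_distrib g g' f := by rw [mul_def, map_add]; rfl
  zero_mul f := by rw [mul_def, map_zero]; rfl
  mul_zero g := map_zero (comp g)

noncomputable instance : Algebra 𝕜 (gHom F F) :=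
  Algebra.ofModule (fun c g f => by rw [mul_def, map_smul]; rfl)
    (fun c g f => map_smul (comp g) c f)

end gHom

end Complexes

end EliasWilliamson

/-!
Contraction with `x : V` is an odd derivation of the composition of `Hom_FM` that anticommutes with
`κ` and kills `Θ`. Contracting the equation `δ ∘ δ + κ(δ) = Θ` therefore shows that `x ⌢ δ` is a
cocycle, and the derivation rule applied to the differential of an arbitrary `f` reads
`d(x ⌢ f) + x ⌢ d(f) = (x ⌢ δ_G) ∘ f - f ∘ (x ⌢ δ_F)`. So the classes `[x ⌢ δ]` are natural in the
complex. For `F = G` this says that they are central in `gEnd(F)`, which is what is needed to extend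
`x ↦ [x ⌢ δ_F]` to the symmetric algebra. Right multiplication by `R^∨` only touches the last tensor
factor, hence commutes with composition and with the differential.
-/

namespace Cohomology

variable {𝕜 X : Type*} [CommRing 𝕜] [AddCommGroup X] [Module 𝕜 X] {d : X →ₗ[𝕜] X}

theorem mem_classes_iff {N : Submodule 𝕜 X} {z : Cohomology d} :
    z ∈ classes d N ↔ ∃ x, ∃ hx : d x = 0, x ∈ N ∧ mk x hx = z :=
  ⟨fun ⟨⟨x, hx⟩, hxN, hz⟩ => ⟨x, hx, hxN, hz⟩, fun ⟨x, hx, hxN, hz⟩ => ⟨⟨x, hx⟩, hxN, hz⟩⟩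

theorem mk_mem_classes {N : Submodule 𝕜 X} {x : X} (hx : d x = 0) (hxN : x ∈ N) :
    mk x hx ∈ classes d N :=
  mem_classes_iff.mpr ⟨x, hx, hxN, rfl⟩

variable (d) in
/-- The action on the cohomology of `d` of the linear maps that commute with `d`. -/
def mapEnd : Subalgebra.centralizer 𝕜 {d} →ₐ[𝕜] Module.End 𝕜 (Cohomology d) :=
  have comm (T : Subalgebra.centralizer 𝕜 {d}) (x : X) : d (T.1 x) = T.1 (d x) :=
    LinearMap.congr_fun (T.2 d rfl) x
  AlgHom.ofLinearMap
    { toFun T := Submodule.mapQ _ _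
        (T.1.restrict (p := LinearMap.ker d) (q := LinearMap.ker d) fun x hx => by
          rw [LinearMap.mem_ker, comm, LinearMap.mem_ker.mp hx, map_zero])
        (by
          rintro ⟨_, _⟩ ⟨x, rfl⟩
          exact ⟨T.1 x, comm T x⟩)
      map_add' _ _ := LinearMap.ext (ind fun _ _ => rfl)
      map_smul' _ _ := LinearMap.ext (ind fun _ _ => rfl) }
    (LinearMap.ext (ind fun _ _ => rfl))
    (fun _ _ => LinearMap.ext (ind fun _ _ => rfl))

theorem mapEnd_mk (T : Subalgebra.centralizer 𝕜 {d}) (x : X) (hx : d x = 0)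
    (hTx : d (T.1 x) = 0) : mapEnd d T (mk x hx) = mk (T.1 x) hTx := rfl

end Cohomology

section Graded

variable {𝕜 N : Type*} [CommRing 𝕜] [AddCommGroup N] [Module 𝕜 N]

instance : SetLike.GradedMonoid (symDeg 𝕜 N) :=
  Submodule.nat_power_gradedMonoid (LinearMap.range (SymmetricAlgebra.ι 𝕜 N))

theorem contractLeft_eq_zero_of_mem_exteriorPower_zero (d : Module.Dual 𝕜 N)
    {r : ExteriorAlgebra 𝕜 N} (hr : r ∈ ⋀[𝕜]^0 N) :
    CliffordAlgebra.contractLeft (Q := (0 : QuadraticForm 𝕜 N)) d r = 0 := by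
  obtain ⟨c, rfl⟩ := Submodule.mem_one.mp ((pow_zero (LinearMap.range _)).le hr)
  exact CliffordAlgebra.contractLeft_algebraMap _ d c

theorem contractLeft_mem_exteriorPower (d : Module.Dual 𝕜 N) (k : ℕ)
    {r : ExteriorAlgebra 𝕜 N} (hr : r ∈ ⋀[𝕜]^(k + 1) N) :
    CliffordAlgebra.contractLeft (Q := (0 : QuadraticForm 𝕜 N)) d r ∈ ⋀[𝕜]^k N := by
  rw [ExteriorAlgebra.exteriorPower, pow_succ'] at hr
  induction hr using Submodule.mul_induction_on' with
  | add a _ b _ ha hb => rw [map_add]; exact add_mem ha hb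
  | mem_mul_mem a ha b hb =>
    obtain ⟨v, rfl⟩ := ha
    rw [ExteriorAlgebra.ι, CliffordAlgebra.contractLeft_ι_mul]
    refine sub_mem (Submodule.smul_mem _ _ hb) ?_
    cases k with
    | zero =>
      rw [contractLeft_eq_zero_of_mem_exteriorPower_zero d hb, mul_zero]
      exact zero_mem _
    | succ k =>
      rw [ExteriorAlgebra.exteriorPower, pow_succ']
      exact Submodule.mul_mem_mul ⟨v, rfl⟩ (contractLeft_mem_exteriorPower d k hb)

end Graded

section Monodromy

open scoped TensorProduct

variable {B W : Type*} [Group W] {M : CoxeterMatrix B} {cs : CoxeterSystem M W}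
  {𝕜 V : Type*} [CommRing 𝕜] [AddCommGroup V] [Module 𝕜 V] {𝔥 : Realization cs 𝕜 V}
  {E : LocalRel 𝔥} {F G H : DSeq B}

theorem DHom.comp_mem_deg {u v w : List B} {g : DHom E v w} {f : DHom E u v} {m n : ℤ}
    (hg : g ∈ deg E v w m) (hf : f ∈ deg E u v n) : comp g f ∈ deg E u w (m + n) := by
  obtain ⟨d, hd, rfl⟩ := hg
  obtain ⟨e, he, rfl⟩ := hf
  exact ⟨_, .comp hd he, rfl⟩

theorem DHom.id_mem_deg (v : List B) : id E v ∈ deg E v v 0 := ⟨_, .id v, rfl⟩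

theorem BEHom.comp_mem_deg {g : BEHom E G H} {f : BEHom E F G} {i j i' j' : ℤ}
    (hg : g ∈ deg E G H i j) (hf : f ∈ deg E F G i' j') :
    comp g f ∈ deg E F H (i + i') (j + j') := by
  intro a c
  rw [comp_apply]
  refine ⟨fun h => sum_mem fun b _ => ?_, fun h => Finset.sum_eq_zero fun b _ => ?_⟩ <;>
    by_cases hb : G.pos b - F.pos a = i' - j'
  · rw [show H.shift c + (j + j') - F.shift a =
      H.shift c + j - G.shift b + (G.shift b + j' - F.shift a) by ring]
    exact DHom.comp_mem_deg ((hg b c).1 (by lia)) ((hf a b).1 hb)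
  · rw [(hf a b).2 hb, map_zero]
    exact zero_mem _
  · rw [(hg b c).2 (by lia), map_zero, LinearMap.zero_apply]
  · rw [(hf a b).2 hb, map_zero]

theorem BEHom.id_mem_deg : id E F ∈ deg E F F 0 0 := by
  intro a b
  obtain rfl | h := eq_or_ne a b
  · simpa [id] using DHom.id_mem_deg (F.word a)
  · simp [id, h]

namespace FMHom

section LinearMaps

variable {X : Type*} [AddCommGroup X] [Module 𝕜 X]

theorem linearMap_ext {T T' : FMHom E F G →ₗ[𝕜] X}
    (h : ∀ r f x, T (r ⊗ₜ (f ⊗ₜ x)) = T' (r ⊗ₜ (f ⊗ₜ x))) : T = T' :=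
  TensorProduct.ext <| LinearMap.ext fun r => TensorProduct.ext' (h r)

theorem linearMap_ext₂ {β β' : FMHom E G H →ₗ[𝕜] FMHom E F G →ₗ[𝕜] X}
    (h : ∀ r f x s g y, β (r ⊗ₜ (f ⊗ₜ x)) (s ⊗ₜ (g ⊗ₜ y)) =
      β' (r ⊗ₜ (f ⊗ₜ x)) (s ⊗ₜ (g ⊗ₜ y))) : β = β' :=
  linearMap_ext fun r f x => linearMap_ext (h r f x)

theorem map_mem_of_mem_deg {i j : ℤ} (T : FMHom E F G →ₗ[𝕜] X) {P : Submodule 𝕜 X}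
    (hT : ∀ {k l : ℕ} {a b : ℤ}, k + a = i → 2 * k + b - 2 * l = j →
      ∀ r ∈ ⋀[𝕜]^k (Module.Dual 𝕜 V), ∀ f ∈ BEHom.deg E F G a b, ∀ x ∈ symDeg 𝕜 V l,
        T (r ⊗ₜ (f ⊗ₜ x)) ∈ P)
    {z : FMHom E F G} (hz : z ∈ deg E F G i j) : T z ∈ P := by
  suffices deg E F G i j ≤ P.comap T from this hz
  refine Submodule.span_le.mpr ?_
  rintro _ ⟨k, l, a, b, hi, hj, r, hr, f, hf, x, hx, rfl⟩
  exact hT hi hj r hr f hf x hx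

end LinearMaps

theorem tmul_mem_deg {k l : ℕ} {a b i j : ℤ} (hi : k + a = i) (hj : 2 * k + b - 2 * l = j)
    {r : ExteriorAlgebra 𝕜 (Module.Dual 𝕜 V)} (hr : r ∈ ⋀[𝕜]^k (Module.Dual 𝕜 V))
    {f : BEHom E F G} (hf : f ∈ BEHom.deg E F G a b) {x : SymmetricAlgebra 𝕜 V}
    (hx : x ∈ symDeg 𝕜 V l) : r ⊗ₜ (f ⊗ₜ x) ∈ deg E F G i j :=
  Submodule.subset_span ⟨k, l, a, b, hi, hj, r, hr, f, hf, x, hx, rfl⟩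

theorem id_mem_deg : id E F ∈ deg E F F 0 0 :=
  tmul_mem_deg (k := 0) (l := 0) (by simp) (by simp)
    (SetLike.one_mem_graded fun k : ℕ => ⋀[𝕜]^k (Module.Dual 𝕜 V)) BEHom.id_mem_deg
    (SetLike.one_mem_graded (symDeg 𝕜 V))

theorem comp_tmul_of_mem_deg {a b : ℤ} {k : ℕ} {f : BEHom E G H} (hf : f ∈ BEHom.deg E G H a b)
    {s : ExteriorAlgebra 𝕜 (Module.Dual 𝕜 V)} (hs : s ∈ ⋀[𝕜]^k (Module.Dual 𝕜 V))
    (r : ExteriorAlgebra 𝕜 (Module.Dual 𝕜 V)) (x : SymmetricAlgebra 𝕜 V) (g : BEHom E F G)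
    (y : SymmetricAlgebra 𝕜 V) :
    comp (r ⊗ₜ[𝕜] (f ⊗ₜ[𝕜] x)) (s ⊗ₜ[𝕜] (g ⊗ₜ[𝕜] y)) =
      (a * k).negOnePow • ((r * s) ⊗ₜ[𝕜] (BEHom.comp f g ⊗ₜ[𝕜] (x * y))) := by
  rw [comp_tmul, BEHom.even_of_mem_deg hf, BEHom.odd_of_mem_deg hf, involute_of_mem hs]
  split_ifs with ha
  · simp [Int.negOnePow_even _ (ha.mul_right k)]
  · obtain hk | hk := k.even_or_odd
    · have hak : Even (a * k) := ((Int.even_coe_nat k).mpr hk).mul_left a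
      simp [hk.neg_one_pow, Int.negOnePow_even _ hak]
    · have hak : Odd (a * k) := (Int.not_even_iff_odd.mp ha).mul ((Int.odd_coe_nat k).mpr hk)
      simp [hk.neg_one_pow, Int.negOnePow_odd _ hak, TensorProduct.neg_tmul]

theorem comp_mem_deg {g : FMHom E G H} {f : FMHom E F G} {i j i' j' : ℤ}
    (hg : g ∈ deg E G H i j) (hf : f ∈ deg E F G i' j') :
    comp g f ∈ deg E F H (i + i') (j + j') := by
  refine map_mem_of_mem_deg (comp.flip f) (fun {k l a b} hi hj r hr g hg x hx => ?_) hg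
  refine map_mem_of_mem_deg (comp _) (fun {k' l' a' b'} hi' hj' s hs f hf y hy => ?_) hf
  rw [comp_tmul_of_mem_deg hg hs, Units.smul_def]
  refine zsmul_mem (tmul_mem_deg (k := k + k') (l := l + l') ?_ ?_ (SetLike.mul_mem_graded hr hs)
    (BEHom.comp_mem_deg hg hf) (SetLike.mul_mem_graded hx hy)) _ <;> push_cast <;> linarith

theorem contract_tmul (x : V) (r : ExteriorAlgebra 𝕜 (Module.Dual 𝕜 V)) (f : BEHom E F G)
    (y : SymmetricAlgebra 𝕜 V) :
    contract x (r ⊗ₜ[𝕜] (f ⊗ₜ[𝕜] y)) =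
      CliffordAlgebra.contractLeft (Module.Dual.eval 𝕜 V x) r ⊗ₜ[𝕜] (f ⊗ₜ[𝕜] y) := rfl

/-- The contraction `x ⌢ f`, as a linear function of `x` and `f`. -/
noncomputable def contractₗ : V →ₗ[𝕜] FMHom E F G →ₗ[𝕜] FMHom E F G where
  toFun := contract
  map_add' x y := by simp only [contract, mapLam, map_add, TensorProduct.map_add_left]
  map_smul' c x := by
    simp only [contract, mapLam, map_smul, TensorProduct.map_smul_left, RingHom.id_apply]

theorem contract_mem_deg (x : V) {f : FMHom E F G} {i j : ℤ} (hf : f ∈ deg E F G i j) :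
    contract x f ∈ deg E F G (i - 1) (j - 2) := by
  refine map_mem_of_mem_deg _ (fun {k l a b} hi hj r hr f hf y hy => ?_) hf
  rw [contract_tmul]
  cases k with
  | zero =>
    rw [contractLeft_eq_zero_of_mem_exteriorPower_zero _ hr, TensorProduct.zero_tmul]
    exact zero_mem _
  | succ k =>
    push_cast at hi hj
    exact tmul_mem_deg (by linarith) (by linarith) (contractLeft_mem_exteriorPower _ k hr) hf hy

theorem contract_comp (x : V) (g : FMHom E G H) (f : FMHom E F G) :
    contract x (comp g f) = comp (contract x g) f + comp (sgn g) (contract x f) := by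
  suffices (comp (G := G)).compr₂ (contract x) =
      comp ∘ₗ contract x + (comp ∘ₗ sgn).compl₂ (contract x) from LinearMap.congr_fun₂ this g f
  refine linearMap_ext₂ fun r g y s f z => ?_
  simp only [LinearMap.compr₂_apply, LinearMap.add_apply, LinearMap.compl₂_apply,
    LinearMap.comp_apply, comp_tmul, contract_tmul, sgn_tmul, map_add, map_sub, map_neg,
    contractLeft_mul, contractLeft_involute, BEHom.even_even, BEHom.even_odd, BEHom.odd_even,
    BEHom.odd_odd, LinearMap.neg_apply, TensorProduct.neg_tmul, TensorProduct.tmul_neg,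
    TensorProduct.add_tmul, mul_neg, sub_zero, zero_sub]
  abel

theorem contract_sgn (x : V) (f : FMHom E F G) : contract x (sgn f) = -sgn (contract x f) := by
  suffices contract x ∘ₗ sgn = -sgn ∘ₗ contract x from LinearMap.congr_fun this f
  refine linearMap_ext fun r f y => ?_
  simp only [LinearMap.comp_apply, LinearMap.neg_apply, sgn_tmul, contract_tmul,
    contractLeft_involute, TensorProduct.neg_tmul]

theorem rightMul_tmul (y : SymmetricAlgebra 𝕜 V) (r : ExteriorAlgebra 𝕜 (Module.Dual 𝕜 V))
    (f : BEHom E F G) (x : SymmetricAlgebra 𝕜 V) :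
    rightMul y (r ⊗ₜ[𝕜] (f ⊗ₜ[𝕜] x)) = r ⊗ₜ[𝕜] (f ⊗ₜ[𝕜] (x * y)) := rfl

variable (E F G) in
/-- The right action of `R^∨`, as an algebra homomorphism from the opposite algebra. -/
noncomputable def rightMulHom : (SymmetricAlgebra 𝕜 V)ᵐᵒᵖ →ₐ[𝕜] Module.End 𝕜 (FMHom E F G) :=
  (Module.End.lTensorAlgHom 𝕜 _ _).comp <|
    (Module.End.lTensorAlgHom 𝕜 _ _).comp <| Algebra.lsmul 𝕜 𝕜 (SymmetricAlgebra 𝕜 V)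

theorem rightMul_mem_deg {y : SymmetricAlgebra 𝕜 V} {l : ℕ} (hy : y ∈ symDeg 𝕜 V l)
    {f : FMHom E F G} {i j : ℤ} (hf : f ∈ deg E F G i j) :
    rightMul y f ∈ deg E F G i (j - 2 * l) := by
  refine map_mem_of_mem_deg _ (fun {k l' a b} hi hj r hr f hf x hx => ?_) hf
  refine tmul_mem_deg hi ?_ hr hf (SetLike.mul_mem_graded hx hy)
  push_cast
  linarith

theorem rightMul_comp (y : SymmetricAlgebra 𝕜 V) (g : FMHom E G H) (f : FMHom E F G) :
    rightMul y (comp g f) = comp (rightMul y g) f := by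
  suffices (comp (G := G)).compr₂ (rightMul y) = comp ∘ₗ rightMul y from
    LinearMap.congr_fun₂ this g f
  refine linearMap_ext₂ fun r g x s f z => ?_
  simp only [LinearMap.compr₂_apply, LinearMap.comp_apply, comp_tmul, rightMul_tmul, map_add,
    mul_right_comm]

theorem comp_rightMul (y : SymmetricAlgebra 𝕜 V) (g : FMHom E G H) (f : FMHom E F G) :
    comp g (rightMul y f) = rightMul y (comp g f) := by
  suffices comp.compl₂ (rightMul y) = comp.compr₂ (rightMul y) from LinearMap.congr_fun₂ this g f
  refine linearMap_ext₂ fun r g x s f z => ?_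
  simp only [LinearMap.compl₂_apply, LinearMap.compr₂_apply, comp_tmul, rightMul_tmul, map_add,
    mul_assoc]

theorem mapLam_rightMul
    (A : ExteriorAlgebra 𝕜 (Module.Dual 𝕜 V) →ₗ[𝕜] ExteriorAlgebra 𝕜 (Module.Dual 𝕜 V))
    (P : BEHom E F G →ₗ[𝕜] BEHom E F G) (y : SymmetricAlgebra 𝕜 V) (f : FMHom E F G) :
    mapLam A P (rightMul y f) = rightMul y (mapLam A P f) := by
  suffices mapLam A P ∘ₗ rightMul y = rightMul y ∘ₗ mapLam A P from LinearMap.congr_fun this f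
  exact linearMap_ext fun _ _ _ => rfl

end FMHom

variable [Module.Free 𝕜 V] [Module.Finite 𝕜 V]

namespace FMHom

theorem contract_kappa (x : V) (f : FMHom E F G) :
    contract x (kappa f) = -kappa (contract x f) := by
  suffices contract x ∘ₗ kappa = -kappa ∘ₗ contract x from LinearMap.congr_fun this f
  refine linearMap_ext fun r f y => ?_
  simp only [LinearMap.comp_apply, LinearMap.neg_apply, contract_tmul, kappa_tmul, map_sum,
    ← Finset.sum_neg_distrib]
  refine Finset.sum_congr rfl fun i _ => ?_
  rw [CliffordAlgebra.contractLeft_comm, TensorProduct.neg_tmul]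

theorem contract_Theta (x : V) : contract x (Theta E F) = 0 := by
  simp only [Theta, map_sum, contract_tmul, CliffordAlgebra.contractLeft_one,
    TensorProduct.zero_tmul, Finset.sum_const_zero]

theorem kappa_rightMul (y : SymmetricAlgebra 𝕜 V) (f : FMHom E F G) :
    kappa (rightMul y f) = rightMul y (kappa f) := by
  simp only [kappa, LinearMap.sum_apply, mapLam_rightMul, map_sum]

end FMHom

namespace FMObj

theorem contract_δ_mem_deg (F : FMObj E) (x : V) :
    FMHom.contract x F.δ ∈ FMHom.deg E F.seq F.seq 0 (-2) := by
  simpa using FMHom.contract_mem_deg x F.δ_mem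

theorem sgn_contract_δ (F : FMObj E) (x : V) :
    FMHom.sgn (FMHom.contract x F.δ) = FMHom.contract x F.δ := by
  rw [FMHom.sgn_of_mem_deg (F.contract_δ_mem_deg x), if_pos Even.zero]

theorem diff_contract_δ (F : FMObj E) (x : V) : diff F F (FMHom.contract x F.δ) = 0 := by
  have contracted_mc : FMHom.contract x (FMHom.comp F.δ F.δ + FMHom.kappa F.δ) = 0 := by
    rw [F.δ_comp_δ, FMHom.contract_Theta]
  rw [map_add, FMHom.contract_comp, sgn_δ, FMHom.contract_kappa, map_neg,
    LinearMap.neg_apply] at contracted_mc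
  rw [diff_apply, sgn_contract_δ, ← neg_eq_zero, ← contracted_mc]
  abel

theorem diff_contract_add_contract_diff {F G : FMObj E} (x : V) (f : FMHom E F.seq G.seq) :
    diff F G (FMHom.contract x f) + FMHom.contract x (diff F G f) =
      FMHom.comp (FMHom.contract x G.δ) f - FMHom.comp f (FMHom.contract x F.δ) := by
  simp only [diff_apply, map_add, map_sub, FMHom.contract_kappa, FMHom.contract_comp, sgn_δ,
    FMHom.contract_sgn, FMHom.sgn_sgn, map_neg, LinearMap.neg_apply]
  abel

theorem diff_rightMul (F G : FMObj E) (y : SymmetricAlgebra 𝕜 V) (f : FMHom E F.seq G.seq) :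
    diff F G (FMHom.rightMul y f) = FMHom.rightMul y (diff F G f) := by
  simp only [diff_apply, FMHom.kappa_rightMul, FMHom.comp_rightMul, FMHom.sgn,
    FMHom.mapLam_rightMul, FMHom.rightMul_comp, map_add, map_sub]

end FMObj

namespace gHom

variable {F G H : FMObj E}

theorem comp_mem_deg {g : gHom G H} {f : gHom F G} {i j i' j' : ℤ}
    (hg : g ∈ deg G H i j) (hf : f ∈ deg F G i' j') :
    comp g f ∈ deg F H (i + i') (j + j') := by
  obtain ⟨g, _, hg', rfl⟩ := Cohomology.mem_classes_iff.mp hg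
  obtain ⟨f, _, hf', rfl⟩ := Cohomology.mem_classes_iff.mp hf
  exact Cohomology.mk_mem_classes _ (FMHom.comp_mem_deg hg' hf')

theorem one_mem_deg (F : FMObj E) : (1 : gHom F F) ∈ deg F F 0 0 :=
  Cohomology.mk_mem_classes _ FMHom.id_mem_deg

variable (F G) in
/-- The left action of `gEnd(G)` on `gHom(F, G)` by composition. -/
noncomputable def postcomp : gHom G G →ₐ[𝕜] Module.End 𝕜 (gHom F G) :=
  AlgHom.ofLinearMap comp (LinearMap.ext one_comp)
    fun g g' => LinearMap.ext fun f => comp_assoc g g' f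

variable (F G) in
/-- The right action of `gEnd(F)` on `gHom(F, G)` by composition. -/
noncomputable def precomp : (gHom F F)ᵐᵒᵖ →ₐ[𝕜] Module.End 𝕜 (gHom F G) :=
  AlgHom.ofLinearMap (comp.flip ∘ₗ (MulOpposite.opLinearEquiv 𝕜).symm.toLinearMap)
    (LinearMap.ext comp_one) fun f f' => LinearMap.ext fun g => (comp_assoc g f'.unop f.unop).symm

/-- The class of `x ⌢ δ_F`, as a linear function of `x`. -/
noncomputable def contractClass (F : FMObj E) : V →ₗ[𝕜] gHom F F :=
  Cohomology.mkₗ (FMObj.diff F F) ∘ₗ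
    (FMHom.contractₗ.flip F.δ).codRestrict (LinearMap.ker (FMObj.diff F F)) F.diff_contract_δ

theorem contractClass_apply (F : FMObj E) (x : V) :
    contractClass F x = mk (FMHom.contract x F.δ) (F.diff_contract_δ x) := rfl

theorem contractClass_mem_deg (F : FMObj E) (x : V) : contractClass F x ∈ deg F F 0 (-2) :=
  Cohomology.mk_mem_classes _ (F.contract_δ_mem_deg x)

theorem contractClass_comp (x : V) (f : gHom F G) :
    comp (contractClass G x) f = comp f (contractClass F x) := by
  induction f using Cohomology.ind with | h f hf => ?_
  simp only [contractClass_apply]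
  refine Cohomology.mk_eq_mk_iff.mpr ⟨FMHom.contract x f, ?_⟩
  rw [← FMObj.diff_contract_add_contract_diff, hf, map_zero, add_zero]

theorem contractClass_mem_center (F : FMObj E) (x : V) :
    contractClass F x ∈ Subalgebra.center 𝕜 (gHom F F) :=
  Subalgebra.mem_center_iff.mpr fun f => (contractClass_comp x f).symm

/-- The algebra homomorphism `μ_F` that extends `x ↦ [x ⌢ δ_F]`. It is built with values in the
centre, because the symmetric algebra is only universal for maps to commutative algebras. -/
noncomputable def monodromy (F : FMObj E) : SymmetricAlgebra 𝕜 V →ₐ[𝕜] gHom F F :=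
  (Subalgebra.center 𝕜 (gHom F F)).val.comp <| SymmetricAlgebra.lift <|
    (contractClass F).codRestrict (Subalgebra.toSubmodule (Subalgebra.center 𝕜 (gHom F F)))
      (contractClass_mem_center F)

theorem monodromy_ι (F : FMObj E) (x : V) :
    monodromy F (SymmetricAlgebra.ι 𝕜 V x) = contractClass F x :=
  congrArg Subtype.val (SymmetricAlgebra.lift_ι_apply _ _)

theorem monodromy_unique (F : FMObj E) {ν : SymmetricAlgebra 𝕜 V →ₐ[𝕜] gHom F F}
    (hν : ∀ x, ν (SymmetricAlgebra.ι 𝕜 V x) = contractClass F x) : ν = monodromy F := by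
  ext x
  exact (hν x).trans (monodromy_ι F x).symm

theorem monodromy_comp (x : SymmetricAlgebra 𝕜 V) (f : gHom F G) :
    comp (monodromy G x) f = comp f (monodromy F x) := by
  suffices (postcomp F G).comp (monodromy G) =
      (precomp F G).comp ((monodromy F).toOpposite fun x y => (Commute.all x y).map _) from
    LinearMap.congr_fun (DFunLike.congr_fun this x) f
  ext x f
  change comp (monodromy G (SymmetricAlgebra.ι 𝕜 V x)) f =
    comp f (monodromy F (SymmetricAlgebra.ι 𝕜 V x))
  rw [monodromy_ι, monodromy_ι, contractClass_comp]

theorem monodromy_mem_deg (F : FMObj E) {l : ℕ} {x : SymmetricAlgebra 𝕜 V}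
    (hx : x ∈ symDeg 𝕜 V l) : monodromy F x ∈ deg F F 0 (-2 * l) := by
  induction hx using Submodule.pow_induction_on_left' with
  | algebraMap c =>
    rw [AlgHom.commutes, Algebra.algebraMap_eq_smul_one]
    exact Submodule.smul_mem _ c (one_mem_deg F)
  | add _ _ _ _ _ hμx hμy => rw [map_add]; exact add_mem hμx hμy
  | mem_mul _ hm _ _ _ hμx =>
    obtain ⟨v, rfl⟩ := hm
    rw [map_mul, mul_def, monodromy_ι]
    convert comp_mem_deg (contractClass_mem_deg F v) hμx using 2 <;> lia

variable (F G) in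
/-- The left monodromy action `x ⋆̂ f = μ_G(x) ∘ f`. -/
noncomputable def leftMonodromy : SymmetricAlgebra 𝕜 V →ₐ[𝕜] Module.End 𝕜 (gHom F G) :=
  (postcomp F G).comp (monodromy G)

variable (F G) in
theorem leftMonodromy_apply (x : SymmetricAlgebra 𝕜 V) (f : gHom F G) :
    leftMonodromy F G x f = comp (monodromy G x) f := rfl

theorem leftMonodromy_mem_deg {l : ℕ} {x : SymmetricAlgebra 𝕜 V} (hx : x ∈ symDeg 𝕜 V l)
    {i j : ℤ} {f : gHom F G} (hf : f ∈ deg F G i j) :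
    leftMonodromy F G x f ∈ deg F G i (j - 2 * l) := by
  rw [leftMonodromy_apply]
  convert comp_mem_deg (monodromy_mem_deg G hx) hf using 2 <;> ring

theorem leftMonodromy_comp (x : SymmetricAlgebra 𝕜 V) (g : gHom G H) (f : gHom F G) :
    leftMonodromy F H x (comp g f) = comp (leftMonodromy G H x g) f :=
  (comp_assoc _ g f).symm

theorem comp_leftMonodromy (x : SymmetricAlgebra 𝕜 V) (g : gHom G H) (f : gHom F G) :
    comp g (leftMonodromy F G x f) = leftMonodromy F H x (comp g f) := by
  rw [leftMonodromy_comp, leftMonodromy_apply, leftMonodromy_apply, monodromy_comp x g, comp_assoc]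

variable (F G) in
/-- The right monodromy action, which is induced by the right action on cochains. -/
noncomputable def rightMonodromy :
    (SymmetricAlgebra 𝕜 V)ᵐᵒᵖ →ₐ[𝕜] Module.End 𝕜 (gHom F G) :=
  (Cohomology.mapEnd (FMObj.diff F G)).comp <|
    (FMHom.rightMulHom E F.seq G.seq).codRestrict (Subalgebra.centralizer 𝕜 {FMObj.diff F G})
      fun y => by
        rintro _ rfl
        exact LinearMap.ext (FMObj.diff_rightMul F G y.unop)

theorem rightMonodromy_mk (y : SymmetricAlgebra 𝕜 V) (f : FMHom E F.seq G.seq)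
    (hf : FMObj.diff F G f = 0) :
    rightMonodromy F G (MulOpposite.op y) (mk f hf) =
      mk (FMHom.rightMul y f) (by rw [FMObj.diff_rightMul, hf, map_zero]) :=
  Cohomology.mapEnd_mk _ f hf _

theorem rightMonodromy_mem_deg {l : ℕ} {y : SymmetricAlgebra 𝕜 V} (hy : y ∈ symDeg 𝕜 V l)
    {i j : ℤ} {f : gHom F G} (hf : f ∈ deg F G i j) :
    rightMonodromy F G (MulOpposite.op y) f ∈ deg F G i (j - 2 * l) := by
  obtain ⟨f, _, hf', rfl⟩ := Cohomology.mem_classes_iff.mp hf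
  exact Cohomology.mk_mem_classes _ (FMHom.rightMul_mem_deg hy hf')

theorem rightMonodromy_comp (y : SymmetricAlgebra 𝕜 V) (g : gHom G H) (f : gHom F G) :
    rightMonodromy F H (MulOpposite.op y) (comp g f) =
      comp (rightMonodromy G H (MulOpposite.op y) g) f := by
  induction g using Cohomology.ind
  induction f using Cohomology.ind
  simp only [comp_mk, rightMonodromy_mk, FMHom.rightMul_comp]

theorem comp_rightMonodromy (y : SymmetricAlgebra 𝕜 V) (g : gHom G H) (f : gHom F G) :
    comp g (rightMonodromy F G (MulOpposite.op y) f) =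
      rightMonodromy F H (MulOpposite.op y) (comp g f) := by
  induction g using Cohomology.ind
  induction f using Cohomology.ind
  simp only [comp_mk, rightMonodromy_mk, FMHom.comp_rightMul]

end gHom

end Monodromy

theorem mainTheorem4_general {B W 𝕜 V : Type*} [Group W] {M : CoxeterMatrix B}
    {cs : CoxeterSystem M W} [CommRing 𝕜] [AddCommGroup V] [Module 𝕜 V] [Module.Free 𝕜 V]
    [Module.Finite 𝕜 V] {𝔥 : Realization cs 𝕜 V} (E : LocalRel 𝔥) :
    ∃ (μ : ∀ F : FMObj E, SymmetricAlgebra 𝕜 V →ₐ[𝕜] gHom F F)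
      (L : ∀ F G : FMObj E, SymmetricAlgebra 𝕜 V →ₐ[𝕜] Module.End 𝕜 (gHom F G))
      (R : ∀ F G : FMObj E, (SymmetricAlgebra 𝕜 V)ᵐᵒᵖ →ₐ[𝕜] Module.End 𝕜 (gHom F G)),
      (∀ F x, ∃ h : FMObj.diff F F (FMHom.contract x F.δ) = 0,
        μ F (SymmetricAlgebra.ι 𝕜 V x) = gHom.mk (FMHom.contract x F.δ) h) ∧
      (∀ (F : FMObj E) (ν : SymmetricAlgebra 𝕜 V →ₐ[𝕜] gHom F F),
        (∀ x, ν (SymmetricAlgebra.ι 𝕜 V x) = μ F (SymmetricAlgebra.ι 𝕜 V x)) → ν = μ F) ∧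
      (∀ F (l : ℕ), ∀ x ∈ symDeg 𝕜 V l, μ F x ∈ gHom.deg F F 0 (-2 * l)) ∧
      (∀ F G x (f : gHom F G), L F G x f = gHom.comp (μ G x) f) ∧
      (∀ F G x (f : gHom F G), L F G x f = gHom.comp f (μ F x)) ∧
      (∀ F G (l : ℕ) (i j : ℤ), ∀ x ∈ symDeg 𝕜 V l, ∀ f ∈ gHom.deg F G i j,
        L F G x f ∈ gHom.deg F G i (j - 2 * l)) ∧
      (∀ F G H x (g : gHom G H) (f : gHom F G),
        L F H x (gHom.comp g f) = gHom.comp (L G H x g) f ∧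
        L F H x (gHom.comp g f) = gHom.comp g (L F G x f)) ∧
      (∀ (F G : FMObj E) y (f : FMHom E F.seq G.seq),
        FMObj.diff F G (FMHom.rightMul y f) = FMHom.rightMul y (FMObj.diff F G f)) ∧
      (∀ (F G : FMObj E) y (f : FMHom E F.seq G.seq)
        (hf : FMObj.diff F G f = 0) (hf' : FMObj.diff F G (FMHom.rightMul y f) = 0),
        R F G (MulOpposite.op y) (gHom.mk f hf) = gHom.mk (FMHom.rightMul y f) hf') ∧
      (∀ F G (l : ℕ) (i j : ℤ), ∀ y ∈ symDeg 𝕜 V l, ∀ f ∈ gHom.deg F G i j,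
        R F G (MulOpposite.op y) f ∈ gHom.deg F G i (j - 2 * l)) ∧
      (∀ F G H y (g : gHom G H) (f : gHom F G),
        R F H (MulOpposite.op y) (gHom.comp g f) =
          gHom.comp (R G H (MulOpposite.op y) g) f ∧
        R F H (MulOpposite.op y) (gHom.comp g f) =
          gHom.comp g (R F G (MulOpposite.op y) f)) ∧
      (∀ F G x y (f : gHom F G), R F G (MulOpposite.op y) (L F G x f) =
        L F G x (R F G (MulOpposite.op y) f)) :=
  ⟨gHom.monodromy, gHom.leftMonodromy, gHom.rightMonodromy,
    fun F x => ⟨F.diff_contract_δ x, gHom.monodromy_ι F x⟩,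
    fun F _ hν => gHom.monodromy_unique F fun x => (hν x).trans (gHom.monodromy_ι F x),
    fun F _ _ hx => gHom.monodromy_mem_deg F hx,
    gHom.leftMonodromy_apply,
    fun _ _ => gHom.monodromy_comp,
    fun _ _ _ _ _ _ hx _ hf => gHom.leftMonodromy_mem_deg hx hf,
    fun _ _ _ x g f => ⟨gHom.leftMonodromy_comp x g f, (gHom.comp_leftMonodromy x g f).symm⟩,
    FMObj.diff_rightMul,
    fun _ _ y f hf _ => gHom.rightMonodromy_mk y f hf,
    fun _ _ _ _ _ _ hy _ hf => gHom.rightMonodromy_mem_deg hy hf,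
    fun _ _ _ y g f => ⟨gHom.rightMonodromy_comp y g f, (gHom.comp_rightMonodromy y g f).symm⟩,
    fun _ G x y f => (gHom.comp_rightMonodromy y (gHom.monodromy G x) f).symm⟩

theorem mainTheorem4 {B W 𝕜 V : Type*} [Finite B] [Group W] {M : CoxeterMatrix B}
    (cs : CoxeterSystem M W) [CommRing 𝕜] [IsDomain 𝕜] [AddCommGroup V] [Module 𝕜 V]
    [Module.Free 𝕜 V] [Module.Finite 𝕜 V] (𝔥 : Realization cs 𝕜 V) (hbal : 𝔥.IsBalanced)
    (hdem : 𝔥.DemazureSurjective) (Z : H3Data 𝔥) :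
    ∃ (μ : ∀ F : FMObj (ewRel Z), SymmetricAlgebra 𝕜 V →ₐ[𝕜] gHom F F)
      (L : ∀ F G : FMObj (ewRel Z), SymmetricAlgebra 𝕜 V →ₐ[𝕜] Module.End 𝕜 (gHom F G))
      (R : ∀ F G : FMObj (ewRel Z), (SymmetricAlgebra 𝕜 V)ᵐᵒᵖ →ₐ[𝕜] Module.End 𝕜 (gHom F G)),
      -- `μ_F` is determined by `μ_F(x) = [x ⌢ δ_F]` for `x ∈ V`, and it is bigraded
      (∀ F x, ∃ h : FMObj.diff F F (FMHom.contract x F.δ) = 0,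
        μ F (SymmetricAlgebra.ι 𝕜 V x) = gHom.mk (FMHom.contract x F.δ) h) ∧
      (∀ (F : FMObj (ewRel Z)) (ν : SymmetricAlgebra 𝕜 V →ₐ[𝕜] gHom F F),
        (∀ x, ν (SymmetricAlgebra.ι 𝕜 V x) = μ F (SymmetricAlgebra.ι 𝕜 V x)) → ν = μ F) ∧
      (∀ F (l : ℕ), ∀ x ∈ symDeg 𝕜 V l, μ F x ∈ gHom.deg F F 0 (-2 * l)) ∧
      -- the left monodromy action
      (∀ F G x (f : gHom F G), L F G x f = gHom.comp (μ G x) f) ∧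
      (∀ F G x (f : gHom F G), L F G x f = gHom.comp f (μ F x)) ∧
      (∀ F G (l : ℕ) (i j : ℤ), ∀ x ∈ symDeg 𝕜 V l, ∀ f ∈ gHom.deg F G i j,
        L F G x f ∈ gHom.deg F G i (j - 2 * l)) ∧
      (∀ F G H x (g : gHom G H) (f : gHom F G),
        L F H x (gHom.comp g f) = gHom.comp (L G H x g) f ∧
        L F H x (gHom.comp g f) = gHom.comp g (L F G x f)) ∧
      -- the right monodromy action
      (∀ (F G : FMObj (ewRel Z)) y (f : FMHom (ewRel Z) F.seq G.seq),
        FMObj.diff F G (FMHom.rightMul y f) = FMHom.rightMul y (FMObj.diff F G f)) ∧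
      (∀ (F G : FMObj (ewRel Z)) y (f : FMHom (ewRel Z) F.seq G.seq)
        (hf : FMObj.diff F G f = 0) (hf' : FMObj.diff F G (FMHom.rightMul y f) = 0),
        R F G (MulOpposite.op y) (gHom.mk f hf) = gHom.mk (FMHom.rightMul y f) hf') ∧
      (∀ F G (l : ℕ) (i j : ℤ), ∀ y ∈ symDeg 𝕜 V l, ∀ f ∈ gHom.deg F G i j,
        R F G (MulOpposite.op y) f ∈ gHom.deg F G i (j - 2 * l)) ∧
      (∀ F G H y (g : gHom G H) (f : gHom F G),
        R F H (MulOpposite.op y) (gHom.comp g f) =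
          gHom.comp (R G H (MulOpposite.op y) g) f ∧
        R F H (MulOpposite.op y) (gHom.comp g f) =
          gHom.comp g (R F G (MulOpposite.op y) f)) ∧
      -- the two actions commute
      (∀ F G x y (f : gHom F G), R F G (MulOpposite.op y) (L F G x f) =
        L F G x (R F G (MulOpposite.op y) f)) :=
  mainTheorem4_general (ewRel Z)
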